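/- A growth function is a nondecreasing function $\Phi:[0,\infty)\to[0,\infty)$ with $\lim_{t\to0}\Phi(t)=\Phi(0)=0$, $\Phi(t)>0$ for $t>0$, and $\lim_{t\to\infty}\Phi(t)=\infty$. It is of lower type if there are $p\in(0,\infty)$ and $C>1$ such that $\Phi(st)\le Ct^p\Phi(s)$ for all $t\in[0,1]$ and $s\in[0,\infty)$. For such $\Phi$, let $H^\Phi(\mathbb D)$ be the space of holomorphic functions $G$ on the unit disc $\mathbb D$ with $$\|G\|_{H^\Phi}^{lux}:=\sup_{0\le r<1}\inf\Big\{\lambda>0:\ \frac1{2\pi}\int_0^{2\pi}\Phi\Big(\frac{|G(re^{i\theta})|}{\lambda}\Big)d\theta\le1\Big\}<\infty .$$ **Theorem.** Let $\Phi$ be a growth function of lower type. There is a constant $C>0$, depending only on $\Phi$, such that the following holds for every $G\in H^\Phi(\mathbb D)$ with $G\not\equiv0$. Let $(z_n)$ be the (finite or infinite, possibly empty) family of the zeros of $G$ in $\mathbb D$, each repeated according to its multiplicity. Then $\sum_n(1-|z_n|)<\infty$, the Blaschke product $$B(z)=\prod_{n}\frac{|z_n|}{z_n}\,\frac{z_n-z}{1-\overline{z_n}z}\qquad(z\in\mathbb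 D)$$ (where the factor is $z$ if $z_n=0$) converges unconditionally at every point of $\mathbb D$, the function $G/B$ (extended holomorphically across the zeros of $B$) belongs to $H^\Phi(\mathbb D)$, and $$C^{-1}\,\|G/B\|_{H^\Phi}^{lux}\le\|G\|_{H^\Phi}^{lux}\le C\,\|G/B\|_{H^\Phi}^{lux}.$$ If moreover $t\mapsto\Phi(t^{1/p})$ is convex on $[0,\infty)$ for some $p\in(0,\infty)$, then $\|G/B\|_{H^\Phi}^{lux}=\|G\|_{H^\Phi}^{lux}$. -/

import Mathlib

open scoped NNReal ENNReal ComplexConjugate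

noncomputable section

namespace HardyOrlicz

/-- Growth functions `Φ : [0, ∞) → [0, ∞)`. -/
structure IsGrowthFunction (Φ : ℝ≥0 → ℝ≥0) : Prop where
  monotone : Monotone Φ
  map_zero : Φ 0 = 0
  tendsto_zero : Filter.Tendsto Φ (nhds 0) (nhds 0)
  pos : ∀ t, 0 < t → 0 < Φ t
  tendsto_atTop : Filter.Tendsto Φ Filter.atTop Filter.atTop

/-- `Φ` is of lower type: for some exponent `p ∈ (0, ∞)` and some constant `C > 1`,
`Φ (s t) ≤ C t ^ p Φ (s)` for all `t ∈ [0, 1]` and all `s ∈ [0, ∞)`. -/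
def IsLowerType (Φ : ℝ≥0 → ℝ≥0) : Prop :=
  ∃ (p : ℝ) (C : ℝ≥0), 0 < p ∧ 1 < C ∧ ∀ t s : ℝ≥0, t ≤ 1 → Φ (s * t) ≤ C * t ^ p * Φ s

/-- The Luxemburg (quasi-)norm of a function on the unit circle,
`inf {c > 0 : (2π)⁻¹ ∫_0^{2π} Φ (|g(e^{iθ})| / c) dθ ≤ 1}`,
with value `∞` if there is no such `c`. -/
def luxNorm (Φ : ℝ≥0 → ℝ≥0) (g : Circle → ℂ) : ℝ≥0∞ :=
  ⨅ c ∈ {c : ℝ≥0 | 0 < c ∧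
    (ENNReal.ofReal (2 * Real.pi))⁻¹ *
      ∫⁻ θ in Set.Ioc 0 (2 * Real.pi), (Φ (‖g (Circle.exp θ)‖₊ / c) : ℝ≥0∞) ≤ 1}, (c : ℝ≥0∞)

/-- The function `G_r (ζ) = G (r ζ)` on the unit circle. -/
def dilate (G : ℂ → ℂ) (r : ℝ) : Circle → ℂ := fun ζ => G (r * ζ)

/-- The Hardy-Orlicz (quasi-)norm `sup_{0 ≤ r < 1} ‖G_r‖`. -/
def hardyNorm (Φ : ℝ≥0 → ℝ≥0) (G : ℂ → ℂ) : ℝ≥0∞ :=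
  ⨆ r ∈ Set.Ico (0 : ℝ) 1, luxNorm Φ (dilate G r)

/-- Membership in the Hardy-Orlicz space of the unit disc. A function on the disc is represented
by any function on `ℂ` extending it; values outside of the disc play no role. -/
def MemHardy (Φ : ℝ≥0 → ℝ≥0) (G : ℂ → ℂ) : Prop :=
  DifferentiableOn ℂ G (Metric.ball 0 1) ∧ hardyNorm Φ G < ∞

/-- The index set of the zeros of `G` in the unit disc, repeated according to multiplicity:
a zero `a` of order `m` occurs as `(a, 0), …, (a, m - 1)`. -/
def ZeroIndex (G : ℂ → ℂ) : Type :=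
  {x : ℂ × ℕ // ‖x.1‖ < 1 ∧ x.2 < analyticOrderNatAt G x.1}

/-- The zeros of `G` in the unit disc, as a family listing each zero with multiplicity. -/
def zeros (G : ℂ → ℂ) (i : ZeroIndex G) : ℂ := i.1.1

/-- The Blaschke factor of `a`; with the usual convention, it is `z` for `a = 0`. -/
def blaschkeFactor (a z : ℂ) : ℂ :=
  if a = 0 then z else (‖a‖ / a) * ((a - z) / (1 - conj a * z))

/-- The Blaschke product of a family of points of the disc. -/
def blaschkeProduct {ι : Type} (a : ι → ℂ) (z : ℂ) : ℂ := ∏' i, blaschkeFactor (a i) z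

end HardyOrlicz

end

noncomputable section

/-! ### Means of convex functions of harmonic functions. -/

namespace HardyOrlicz
open Metric Real InnerProductSpace Set

/-! Suppose first that `t ↦ Φ (t ^ (1 / p))` is convex. Then `s ↦ Φ (exp s / c)` is convex on the
line, so its composition with a harmonic function has circular means that increase with the radius
(`circleAverage_convex_comp_harmonic_mono`). On a disc of radius `R < 1` whose boundary circle
carries no zero of `G`, divide `G` by the finite Blaschke product of its zeros in that disc
(`exists_zeroFree`). The quotient `h` has no zeros, `log ‖h‖` is harmonic, and `‖h‖ = ‖G‖` on the
circle; hence the Orlicz means of `h` inside are bounded by that of `G` at radius `R`.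

A Harnack estimate turns this into a bound for `‖h z‖` at one point, uniform in `R`. It bounds the
finite products of inverse Blaschke factors, which is the Blaschke condition
(`summable_one_sub_norm_zeros`). Letting `R → 1`, Fatou's lemma transfers the bound on the means to
`G / B` (`orliczMean_dilate_quotient_le_one`). The opposite inequality of norms is just `‖B‖ ≤ 1`.

A general `Φ` of lower type is squeezed, up to a dilation of the variable, by a power convex growth
function `Ψ` (`exists_isPowerConvex`). Passing from `Φ` to `Ψ` and back costs only a constant factor
in the norm. -/

lemma _root_.ConvexOn.exists_support_line {ψ : ℝ → ℝ} (hψ : ConvexOn ℝ univ ψ) (x : ℝ) :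
    ∃ m : ℝ, ∀ y, ψ x + m * (y - x) ≤ ψ y := by
  refine ⟨derivWithin ψ (Ioi x) x, fun y => ?_⟩
  have hx : x ∈ interior (univ : Set ℝ) := by simp
  rcases lt_trichotomy x y with h | h | h
  · have h1 := hψ.rightDeriv_le_slope_of_mem_interior hx (mem_univ y) h
    rw [slope_def_field, le_div_iff₀ (by linarith)] at h1
    linarith
  · subst h; simp
  · have h1 := hψ.slope_le_leftDeriv_of_mem_interior (mem_univ y) hx h
    have h2 := h1.trans (hψ.leftDeriv_le_rightDeriv_of_mem_interior hx)
    rw [slope_def_field, div_le_iff₀ (by linarith)] at h2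
    linarith

lemma continuousOn_poissonKernel {z : ℂ} {R : ℝ} (hz : z ∈ ball (0 : ℂ) R) :
    ContinuousOn (poissonKernel 0 z) (sphere 0 R) := by
  rw [poissonKernel_eq_re_herglotzRieszKernel]
  have h := continuousOn_herglotzRieszKernel_sphere hz
  rw [abs_of_pos (pos_of_mem_ball hz)] at h
  exact Complex.continuous_re.comp_continuousOn h

lemma poissonKernel_nonneg {z w : ℂ} {R : ℝ} (hz : z ∈ ball (0 : ℂ) R) (hw : w ∈ sphere 0 R) :
    0 ≤ poissonKernel 0 z w := by
  rw [poissonKernel_def]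
  simp only [mem_ball_zero_iff, mem_sphere_zero_iff_norm, sub_zero] at *
  have : ‖z‖ ^ 2 ≤ ‖w‖ ^ 2 := by gcongr; linarith
  exact div_nonneg (by linarith) (by positivity)

lemma poissonKernel_le {z w : ℂ} {R : ℝ} (hz : z ∈ ball (0 : ℂ) R) (hw : w ∈ sphere 0 R) :
    poissonKernel 0 z w ≤ (R + ‖z‖) / (R - ‖z‖) := by
  rw [poissonKernel_eq_re_herglotzRieszKernel]
  simpa [herglotzRieszKernel_def] using re_herglotzRieszKernel_le hw hz

/-- The symmetry of the Poisson kernel in the angles. -/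
lemma poissonKernel_circleMap_swap (r R s t : ℝ) :
    poissonKernel 0 (circleMap 0 r s) (circleMap 0 R t) =
      poissonKernel 0 (circleMap 0 r t) (circleMap 0 R s) := by
  have key : ∀ a b : ℝ, ‖circleMap 0 R a - circleMap 0 r b‖ ^ 2 =
      R ^ 2 + r ^ 2 - 2 * (R * r) * (cos a * cos b + sin a * sin b) := by
    intro a b
    have e : ∀ (ρ θ : ℝ), circleMap 0 ρ θ = ⟨ρ * cos θ, ρ * sin θ⟩ := by
      intro ρ θ
      apply Complex.ext <;> simp [circleMap, Complex.exp_ofReal_mul_I_re,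
        Complex.exp_ofReal_mul_I_im]
    rw [e, e, ← Complex.normSq_eq_norm_sq, Complex.normSq_apply]
    simp only [Complex.sub_re, Complex.sub_im]
    have h1 := sin_sq_add_cos_sq a
    have h2 := sin_sq_add_cos_sq b
    linear_combination R ^ 2 * h1 + r ^ 2 * h2
  simp only [poissonKernel_def, sub_zero, key, norm_circleMap_zero]
  ring_nf

lemma circleAverage_poissonKernel {z : ℂ} {R : ℝ} (hz : z ∈ ball (0 : ℂ) R) :
    circleAverage (poissonKernel 0 z) 0 R = 1 := by
  have h2 : HarmonicOnNhd (fun _ : ℂ => (1 : ℝ)) (closedBall 0 R) := fun x _ => by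
    simp
  have := h2.circleAverage_poissonKernel_smul hz
  rw [← this]
  congr 1
  ext; simp

variable {u : ℂ → ℝ} {ψ : ℝ → ℝ} {R r : ℝ} {z : ℂ}

lemma continuous_of_convexOn_univ (hψ : ConvexOn ℝ univ ψ) : Continuous ψ := by
  rw [← continuousOn_univ]
  exact hψ.continuousOn isOpen_univ

lemma continuousOn_of_harmonicOnNhd {s : Set ℂ} (hu : HarmonicOnNhd u s) : ContinuousOn u s :=
  fun x hx => (hu x hx).1.continuousAt.continuousWithinAt

/-- A convex function of a harmonic function satisfies the sub-mean value inequality with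
respect to the Poisson kernel. -/
lemma convex_comp_harmonic_le_poisson (hψ : ConvexOn ℝ univ ψ)
    (hu : HarmonicOnNhd u (closedBall 0 R)) (hz : z ∈ ball (0 : ℂ) R) :
    ψ (u z) ≤ circleAverage (fun w => poissonKernel 0 z w * ψ (u w)) 0 R := by
  have hR := pos_of_mem_ball hz
  obtain ⟨m, hm⟩ := hψ.exists_support_line (u z)
  have hP := continuousOn_poissonKernel hz
  have hus : ContinuousOn u (sphere 0 R) :=
    (continuousOn_of_harmonicOnNhd hu).mono sphere_subset_closedBall
  have hpu := hu.circleAverage_poissonKernel_smul hz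
  -- Jensen's inequality by hand: the Poisson kernel has mean `1` and reproduces `u`, so the
  -- supporting line at `u z` averages to exactly `ψ (u z)`.
  have h1 : circleAverage (fun w => (ψ (u z) - m * u z) • poissonKernel 0 z w
      + m • (poissonKernel 0 z w * u w)) 0 R = ψ (u z) := by
    rw [circleAverage_fun_add, circleAverage_fun_smul, circleAverage_fun_smul,
      circleAverage_poissonKernel hz]
    · have : circleAverage (fun w => poissonKernel 0 z w * u w) 0 R = u z := hpu
      rw [this]; simp
    · exact (hP.fun_const_smul _).circleIntegrable hR.le
    · exact ((hP.fun_mul hus).fun_const_smul _).circleIntegrable hR.le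
  rw [← h1]
  apply circleAverage_mono
  · exact ((hP.fun_const_smul _).fun_add ((hP.fun_mul hus).fun_const_smul _)).circleIntegrable hR.le
  · exact (hP.mul ((continuous_of_convexOn_univ hψ).comp_continuousOn hus)).circleIntegrable hR.le
  · intro w hw
    rw [abs_of_pos hR] at hw
    have h2 := mul_le_mul_of_nonneg_left (hm (u w)) (poissonKernel_nonneg hz hw)
    simp only [smul_eq_mul]
    linarith

/-- Harnack's upper bound for the Poisson kernel, usable because `ψ` is nonnegative. It later
converts a bound on the mean into a pointwise bound. -/
lemma convex_comp_harmonic_le (hψ : ConvexOn ℝ univ ψ) (h0 : ∀ s, 0 ≤ ψ s)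
    (hu : HarmonicOnNhd u (closedBall 0 R)) (hz : z ∈ ball (0 : ℂ) R) :
    ψ (u z) ≤ (R + ‖z‖) / (R - ‖z‖) * circleAverage (fun w => ψ (u w)) 0 R := by
  have hR := pos_of_mem_ball hz
  have hus : ContinuousOn (fun w => ψ (u w)) (sphere 0 R) :=
    (continuous_of_convexOn_univ hψ).comp_continuousOn
    ((continuousOn_of_harmonicOnNhd hu).mono sphere_subset_closedBall)
  refine (convex_comp_harmonic_le_poisson hψ hu hz).trans ?_
  rw [← smul_eq_mul, ← circleAverage_fun_smul]
  apply circleAverage_mono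
  · exact ((continuousOn_poissonKernel hz).mul hus).circleIntegrable hR.le
  · exact (hus.fun_const_smul _).circleIntegrable hR.le
  · intro w hw
    rw [abs_of_pos hR] at hw
    exact mul_le_mul_of_nonneg_right (poissonKernel_le hz hw) (h0 _)

/-- Integral means of a convex function of a harmonic function increase with the radius. -/
lemma circleAverage_convex_comp_harmonic_mono (hψ : ConvexOn ℝ univ ψ)
    (hu : HarmonicOnNhd u (closedBall 0 R)) (h0r : 0 ≤ r) (hrR : r < R) :
    circleAverage (fun w => ψ (u w)) 0 r ≤ circleAverage (fun w => ψ (u w)) 0 R := by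
  have hR : 0 < R := by linarith
  have hψc := continuous_of_convexOn_univ hψ
  have hus : ContinuousOn (fun w => ψ (u w)) (closedBall 0 R) :=
    hψc.comp_continuousOn (continuousOn_of_harmonicOnNhd hu)
  have hin : ∀ s, circleMap 0 r s ∈ ball (0 : ℂ) R := fun s => by
    simp [abs_of_nonneg h0r, hrR]
  have hmR : ∀ s, circleMap 0 R s ∈ sphere (0 : ℂ) R := fun s => by
    simp [abs_of_pos hR]
  have hcR : Continuous fun t => ψ (u (circleMap 0 R t)) :=
    hus.comp_continuous (continuous_circleMap 0 R) fun t => sphere_subset_closedBall (hmR t)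
  have hcr : Continuous fun t => ψ (u (circleMap 0 r t)) :=
    hus.comp_continuous (continuous_circleMap 0 r) fun t => ball_subset_closedBall (hin t)
  have hK : Continuous fun p : ℝ × ℝ =>
      poissonKernel 0 (circleMap 0 r p.1) (circleMap 0 R p.2) := by
    simp only [poissonKernel_def, sub_zero]
    refine Continuous.div (by fun_prop) (by fun_prop) fun p => ?_
    have : circleMap 0 R p.2 - circleMap 0 r p.1 ≠ 0 := by
      intro h
      rw [sub_eq_zero] at h
      have := hin p.1
      rw [← h] at this
      have h3 := hmR p.2
      simp only [mem_ball_zero_iff, mem_sphere_zero_iff_norm] at this h3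
      linarith
    exact pow_ne_zero 2 (norm_ne_zero_iff.2 this)
  have hpi : (0 : ℝ) ≤ 2 * π := by positivity
  have h1 : ∀ s, ψ (u (circleMap 0 r s)) ≤ (2 * π)⁻¹ * ∫ t in (0 : ℝ)..2 * π,
      poissonKernel 0 (circleMap 0 r s) (circleMap 0 R t) * ψ (u (circleMap 0 R t)) := fun s =>
    convex_comp_harmonic_le_poisson hψ hu (hin s)
  have hK2 : Continuous (Function.uncurry fun s t : ℝ =>
      poissonKernel 0 (circleMap 0 r s) (circleMap 0 R t) * ψ (u (circleMap 0 R t))) :=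
    hK.mul (hcR.comp continuous_snd)
  have h2 : (∫ s in (0 : ℝ)..2 * π, ψ (u (circleMap 0 r s))) ≤
      ∫ s in (0 : ℝ)..2 * π, (2 * π)⁻¹ * ∫ t in (0 : ℝ)..2 * π,
      poissonKernel 0 (circleMap 0 r s) (circleMap 0 R t) * ψ (u (circleMap 0 R t)) := by
    apply intervalIntegral.integral_mono_on hpi (hcr.intervalIntegrable _ _)
    · exact (continuous_const.mul
        (intervalIntegral.continuous_parametric_intervalIntegral_of_continuous'
          hK2 _ _)).intervalIntegrable _ _
    · exact fun s _ => h1 s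
  -- After Fubini the kernel is integrated over the angle of the inner point; by symmetry this mean
  -- is again `1`.
  have h3 : ∀ t, (2 * π)⁻¹ * (∫ s in (0 : ℝ)..2 * π,
      poissonKernel 0 (circleMap 0 r s) (circleMap 0 R t)) = 1 := by
    intro t
    simp_rw [poissonKernel_circleMap_swap r R _ t]
    exact circleAverage_poissonKernel (hin t)
  rw [circleAverage_def, circleAverage_def, smul_eq_mul, smul_eq_mul]
  refine mul_le_mul_of_nonneg_left (h2.trans_eq ?_) (by positivity)
  rw [intervalIntegral.integral_const_mul,
    MeasureTheory.intervalIntegral_intervalIntegral_swap ?_,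
    ← intervalIntegral.integral_const_mul]
  swap
  · exact (hK2.continuousOn.integrableOn_compact (isCompact_uIcc.prod isCompact_uIcc)).mono_set
      (prod_mono uIoc_subset_uIcc uIoc_subset_uIcc)
  congr 1
  ext t
  rw [intervalIntegral.integral_mul_const, ← mul_assoc, h3, one_mul]

end HardyOrlicz

/-! ### Orlicz means and the substitution of an exponential. -/

namespace HardyOrlicz
open Metric Real Set MeasureTheory Filter Topology

variable {Φ : ℝ≥0 → ℝ≥0}

/-- The mean over the unit circle occurring in the definition of `luxNorm`. -/
def orliczMean (Φ : ℝ≥0 → ℝ≥0) (g : Circle → ℂ) (c : ℝ≥0) : ℝ≥0∞ :=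
  (ENNReal.ofReal (2 * π))⁻¹ * ∫⁻ θ in Ioc 0 (2 * π), (Φ (‖g (Circle.exp θ)‖₊ / c) : ℝ≥0∞)

lemma orliczMean_mono_fun (hΦ : Monotone Φ) {f g : Circle → ℂ} (h : ∀ ζ, ‖f ζ‖ ≤ ‖g ζ‖)
    (c : ℝ≥0) : orliczMean Φ f c ≤ orliczMean Φ g c := by
  unfold orliczMean
  gcongr with θ
  refine hΦ ?_
  gcongr
  exact h _

lemma orliczMean_antitone (hΦ : Monotone Φ) (g : Circle → ℂ) {c d : ℝ≥0} (hc : 0 < c)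
    (hcd : c ≤ d) : orliczMean Φ g d ≤ orliczMean Φ g c := by
  unfold orliczMean
  gcongr with θ
  refine hΦ ?_
  gcongr

lemma luxNorm_le {g : Circle → ℂ} {c : ℝ≥0} (hc : 0 < c) (h : orliczMean Φ g c ≤ 1) :
    luxNorm Φ g ≤ c :=
  iInf₂_le c ⟨hc, h⟩

lemma orliczMean_le_one (hΦ : Monotone Φ) {g : Circle → ℂ} {c : ℝ≥0} (h : luxNorm Φ g < c) :
    orliczMean Φ g c ≤ 1 := by
  obtain ⟨d, hd, hdc⟩ := (iInf_lt_iff.1 h).imp fun _ => iInf_lt_iff.1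
  exact (orliczMean_antitone hΦ g hd.1 (by exact_mod_cast hdc.le)).trans hd.2

lemma luxNorm_le_luxNorm {Ψ : ℝ≥0 → ℝ≥0} {f g : Circle → ℂ}
    (h : ∀ c, 0 < c → orliczMean Φ g c ≤ 1 → orliczMean Ψ f c ≤ 1) :
    luxNorm Ψ f ≤ luxNorm Φ g := by
  refine le_iInf₂ fun c hc => luxNorm_le hc.1 (h c hc.1 hc.2)

lemma luxNorm_mono_fun (hΦ : Monotone Φ) {f g : Circle → ℂ} (h : ∀ ζ, ‖f ζ‖ ≤ ‖g ζ‖) :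
    luxNorm Φ f ≤ luxNorm Φ g :=
  luxNorm_le_luxNorm fun c _ hc => (orliczMean_mono_fun hΦ h c).trans hc

lemma luxNorm_le_hardyNorm {G : ℂ → ℂ} {r : ℝ} (hr : r ∈ Ico (0 : ℝ) 1) :
    luxNorm Φ (dilate G r) ≤ hardyNorm Φ G :=
  le_iSup₂ (f := fun r (_ : r ∈ Ico (0 : ℝ) 1) => luxNorm Φ (dilate G r)) r hr

lemma dilate_mem_ball {r : ℝ} (hr : r ∈ Ico (0 : ℝ) 1) (ζ : Circle) :
    (r * ζ : ℂ) ∈ ball (0 : ℂ) 1 := by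
  have h : ‖(ζ : ℂ)‖ = 1 := Circle.norm_coe ζ
  simp [abs_of_nonneg hr.1, hr.2, h]

lemma hardyNorm_mono_fun (hΦ : Monotone Φ) {F G : ℂ → ℂ}
    (h : ∀ z ∈ ball (0 : ℂ) 1, ‖F z‖ ≤ ‖G z‖) : hardyNorm Φ F ≤ hardyNorm Φ G :=
  iSup₂_mono fun _ hr => luxNorm_mono_fun hΦ fun ζ => h _ (dilate_mem_ball hr ζ)

lemma hardyNorm_mono_growth {Ψ : ℝ≥0 → ℝ≥0} (h : ∀ t, Ψ t ≤ Φ t) (G : ℂ → ℂ) :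
    hardyNorm Ψ G ≤ hardyNorm Φ G := by
  refine iSup₂_mono fun r _ => le_iInf₂ fun c hc => luxNorm_le hc.1 (le_trans ?_ hc.2)
  unfold orliczMean
  gcongr with θ
  exact h _

lemma hardyNorm_le_mul {Ψ : ℝ≥0 → ℝ≥0} {K : ℝ≥0} (hK : 0 < K) (h : ∀ t, Φ (t / K) ≤ Ψ t)
    (G : ℂ → ℂ) : hardyNorm Φ G ≤ K * hardyNorm Ψ G := by
  refine iSup₂_le fun r hr => le_trans ?_ (mul_le_mul_right (luxNorm_le_hardyNorm hr) _)
  unfold luxNorm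
  rw [ENNReal.mul_iInf_of_ne (by exact_mod_cast hK.ne') (by simp)]
  refine le_iInf fun c => ?_
  rw [ENNReal.mul_iInf_of_ne (by exact_mod_cast hK.ne') (by simp)]
  refine le_iInf fun hc => ?_
  have hc' : orliczMean Ψ (dilate G r) c ≤ 1 := hc.2
  have := luxNorm_le (Φ := Φ) (g := dilate G r) (mul_pos hK hc.1) (le_trans ?_ hc')
  · exact_mod_cast this
  · unfold orliczMean
    gcongr with θ
    refine (congrArg Φ ?_).trans_le (h _)
    rw [div_div, mul_comm]

/-- `t ↦ Φ (t ^ (1 / p))` is convex for some `p > 0`. -/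
def IsPowerConvex (Φ : ℝ≥0 → ℝ≥0) : Prop :=
  ∃ p : ℝ, 0 < p ∧ ConvexOn ℝ≥0 univ fun t : ℝ≥0 => Φ (t ^ (1 / p))

/-- The function `s ↦ Φ (e ^ s / c)` on the real line. -/
def expGrowth (Φ : ℝ≥0 → ℝ≥0) (c : ℝ≥0) (s : ℝ) : ℝ := Φ ((exp s).toNNReal / c)

lemma expGrowth_nonneg (Φ : ℝ≥0 → ℝ≥0) (c : ℝ≥0) (s : ℝ) : 0 ≤ expGrowth Φ c s := NNReal.coe_nonneg _

lemma expGrowth_log (Φ : ℝ≥0 → ℝ≥0) (c : ℝ≥0) {w : ℂ} (hw : w ≠ 0) :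
    expGrowth Φ c (log ‖w‖) = Φ (‖w‖₊ / c) := by
  rw [expGrowth, exp_log (norm_pos_iff.2 hw), norm_toNNReal]

/-- Since `exp s / c = (exp (p * s) / c ^ p) ^ (1 / p)`, this is the nondecreasing convex function
`t ↦ Φ (t ^ (1 / p))` after a convex exponential. For `c = 0` both sides of the identity are `0`. -/
lemma convexOn_expGrowth (hΦ : Monotone Φ) (hp : IsPowerConvex Φ) (c : ℝ≥0) :
    ConvexOn ℝ univ (expGrowth Φ c) := by
  obtain ⟨p, hp, hN⟩ := hp
  refine ⟨convex_univ, fun x _ y _ a b ha hb hab => ?_⟩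
  have key : ∀ s, (exp s).toNNReal / c = ((exp (p * s)).toNNReal / c ^ p) ^ (1 / p) := by
    intro s
    rw [NNReal.div_rpow, ← NNReal.rpow_mul, mul_one_div_cancel hp.ne', NNReal.rpow_one]
    congr 1
    apply NNReal.coe_injective
    rw [NNReal.coe_rpow, Real.coe_toNNReal _ (exp_pos _).le, Real.coe_toNNReal _ (exp_pos _).le,
      ← exp_mul]
    congr 1
    field_simp
  lift a to ℝ≥0 using ha
  lift b to ℝ≥0 using hb
  have h1 : (exp (p * (a * x + b * y))).toNNReal / c ^ p ≤
      a • ((exp (p * x)).toNNReal / c ^ p) + b • ((exp (p * y)).toNNReal / c ^ p) := by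
    rw [smul_eq_mul, smul_eq_mul, ← mul_div_assoc, ← mul_div_assoc, ← add_div]
    gcongr
    rw [← NNReal.coe_le_coe]
    push_cast
    rw [Real.coe_toNNReal _ (exp_pos _).le, Real.coe_toNNReal _ (exp_pos _).le,
      Real.coe_toNNReal _ (exp_pos _).le]
    have := convexOn_exp.2 (mem_univ (p * x)) (mem_univ (p * y)) a.2 b.2 hab
    simp only [smul_eq_mul] at this
    refine le_trans (le_of_eq ?_) this
    congr 1
    change _ = (a : ℝ) * (p * x) + b * (p * y)
    ring
  have h2 := hN.2 (mem_univ ((exp (p * x)).toNNReal / c ^ p))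
    (mem_univ ((exp (p * y)).toNNReal / c ^ p)) (zero_le) (zero_le)
    (show a + b = 1 by exact_mod_cast hab)
  simp only [expGrowth, smul_eq_mul, key]
  have h3 := (hΦ (NNReal.rpow_le_rpow h1 (by positivity : 0 ≤ 1 / p))).trans h2
  exact_mod_cast h3

lemma continuous_expGrowth (hΦ : Monotone Φ) (hp : IsPowerConvex Φ) (c : ℝ≥0) :
    Continuous (expGrowth Φ c) :=
  continuous_of_convexOn_univ (convexOn_expGrowth hΦ hp c)

/-- Finite convex functions on the whole line are continuous, and `Φ` is recovered from `expGrowth Φ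
1` through the logarithm. The Fatou argument needs this continuity. -/
lemma continuousAt_of_isPowerConvex (hΦ : Monotone Φ) (hp : IsPowerConvex Φ) {t : ℝ≥0}
    (ht : 0 < t) : ContinuousAt Φ t := by
  have h1 : ContinuousAt (fun t : ℝ≥0 => expGrowth Φ 1 (log t)) t :=
    (continuous_expGrowth hΦ hp 1).continuousAt.comp
      ((continuousAt_log (by exact_mod_cast ht.ne')).comp NNReal.continuous_coe.continuousAt)
  have h2 : (fun t : ℝ≥0 => expGrowth Φ 1 (log t)) =ᶠ[𝓝 t] fun t => ((Φ t : ℝ≥0) : ℝ) := by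
    filter_upwards [lt_mem_nhds ht] with s hs
    rw [expGrowth, exp_log (by exact_mod_cast hs)]
    simp
  have h3 := h1.congr h2
  unfold ContinuousAt at h3 ⊢
  exact NNReal.tendsto_coe.1 h3

/-- For functions without zeros, the Orlicz mean is an average of `expGrowth`. -/
lemma orliczMean_dilate_eq {g : ℂ → ℂ} {r : ℝ} {c : ℝ≥0} (hΦ : Monotone Φ)
    (hp : IsPowerConvex Φ) (hr : 0 ≤ r) (hg : ContinuousOn g (sphere 0 r))
    (h0 : ∀ z ∈ sphere (0 : ℂ) r, g z ≠ 0) :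
    orliczMean Φ (dilate g r) c =
      ENNReal.ofReal (circleAverage (fun z => expGrowth Φ c (log ‖g z‖)) 0 r) := by
  have hmem : ∀ θ, circleMap 0 r θ ∈ sphere (0 : ℂ) r := fun θ => circleMap_mem_sphere 0 hr θ
  have hc : Continuous fun θ => expGrowth Φ c (log ‖g (circleMap 0 r θ)‖) := by
    have h1 : Continuous fun θ => ‖g (circleMap 0 r θ)‖ :=
      (hg.comp_continuous (continuous_circleMap 0 r) hmem).norm
    exact (continuous_expGrowth hΦ hp c).comp
      (h1.log fun θ => norm_ne_zero_iff.2 (h0 _ (hmem θ)))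
  have hpi : (0 : ℝ) ≤ 2 * π := by positivity
  rw [orliczMean, circleAverage_def, smul_eq_mul, ENNReal.ofReal_mul (p := (2 * π)⁻¹) (by positivity),
    ENNReal.ofReal_inv_of_pos (by positivity), intervalIntegral.integral_of_le hpi,
    ofReal_integral_eq_lintegral_ofReal]
  · congr 1
    refine lintegral_congr fun θ => ?_
    rw [expGrowth_log _ _ (h0 _ (hmem θ)), ENNReal.ofReal_coe_nnreal]
    simp [dilate, circleMap, Circle.coe_exp]
  · exact (hc.integrableOn_Icc).mono_set Ioc_subset_Icc_self
  · exact ae_of_all _ fun θ => expGrowth_nonneg _ _ _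

end HardyOrlicz

/-! ### Zeros of `G` and division by finite Blaschke products. -/

namespace HardyOrlicz
open Metric Set MeasureTheory Filter Topology Complex

variable {G : ℂ → ℂ}

lemma analyticOnNhd_of_differentiableOn (hG : DifferentiableOn ℂ G (ball 0 1)) :
    AnalyticOnNhd ℂ G (ball 0 1) := hG.analyticOnNhd isOpen_ball

/-- The identity theorem. It matters because `analyticOrderNatAt` takes the value `0` at infinite
order and would then miss the zero. -/
lemma analyticOrderAt_ne_top (hG : DifferentiableOn ℂ G (ball 0 1))
    (h0 : ∃ z ∈ ball (0 : ℂ) 1, G z ≠ 0) {w : ℂ} (hw : w ∈ ball (0 : ℂ) 1) :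
    analyticOrderAt G w ≠ ⊤ := by
  obtain ⟨z, hz, hGz⟩ := h0
  have hA := analyticOnNhd_of_differentiableOn hG
  refine hA.analyticOrderAt_ne_top_of_isPreconnected (convex_ball 0 1).isPreconnected hz hw ?_
  rw [(hA z hz).analyticOrderAt_eq_zero.2 hGz]
  simp

lemma zeros_mem_ball (i : ZeroIndex G) : zeros G i ∈ ball (0 : ℂ) 1 :=
  mem_ball_zero_iff.2 i.2.1

lemma map_zeros (i : ZeroIndex G) : G (zeros G i) = 0 :=
  apply_eq_zero_of_analyticOrderNatAt_ne_zero (Nat.ne_zero_of_lt i.2.2)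

lemma card_filter_zeros_le [DecidableEq ℂ] (S : Finset (ZeroIndex G)) (a : ℂ) :
    (S.filter fun i => zeros G i = a).card ≤ analyticOrderNatAt G a := by
  rw [← Finset.card_range (analyticOrderNatAt G a)]
  refine Finset.card_le_card_of_injOn (fun i => i.1.2) ?_ ?_
  · intro i hi
    simp only [Finset.coe_filter, mem_ofPred_eq] at hi
    obtain ⟨-, rfl⟩ := hi
    exact Finset.mem_coe.2 (Finset.mem_range.2 i.2.2)
  · intro i hi j hj hij
    simp only [Finset.coe_filter, mem_ofPred_eq] at hi hj
    exact Subtype.ext (Prod.ext (hi.2.trans hj.2.symm) hij)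

lemma countable_zeros (hG : DifferentiableOn ℂ G (ball 0 1))
    (h0 : ∃ z ∈ ball (0 : ℂ) 1, G z ≠ 0) : {z ∈ ball (0 : ℂ) 1 | G z = 0}.Countable := by
  obtain ⟨z, hz, hGz⟩ := h0
  have h1 := (analyticOnNhd_of_differentiableOn hG).preimage_zero_mem_codiscreteWithin hGz hz
    ((convex_ball 0 1).isConnected ⟨z, hz⟩)
  have h2 : DiscreteTopology ↑((G ⁻¹' {0}ᶜ)ᶜ ∩ ball (0 : ℂ) 1) := isDiscrete_iff_discreteTopology.mp
    <| isDiscrete_of_codiscreteWithin (by rwa [compl_compl])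
  have h3 : ((G ⁻¹' {0}ᶜ)ᶜ ∩ ball (0 : ℂ) 1).Countable :=
    TopologicalSpace.separableSpace_iff_countable.1 inferInstance
  refine h3.mono fun w hw => ?_
  simp only [mem_ofPred_eq] at hw
  exact ⟨by simp [hw.2], hw.1⟩

/-- Between any two radii there is a circle on which `G` has no zeros. -/
lemma exists_radius_ne_zero (hG : DifferentiableOn ℂ G (ball 0 1))
    (h0 : ∃ z ∈ ball (0 : ℂ) 1, G z ≠ 0) {a b : ℝ} (hab : a < b) (hb : b ≤ 1) :
    ∃ R ∈ Ioo a b, ∀ z ∈ sphere (0 : ℂ) R, G z ≠ 0 := by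
  have h1 := (countable_zeros hG h0).image norm
  -- The moduli of the zeros form a countable set, whereas an interval has the cardinality of the
  -- continuum.
  have h2 : ¬ (Ioo a b).Countable := fun h => by
    have := Cardinal.mk_Ioo_real hab
    have h3 := Cardinal.mk_le_aleph0_iff.2 h
    rw [this] at h3
    exact absurd h3 (not_le.2 Cardinal.aleph0_lt_continuum)
  obtain ⟨R, hR, hR'⟩ := not_subset.1 fun h => h2 (h1.mono h)
  refine ⟨R, hR, fun z hz h => hR' ⟨z, ⟨?_, h⟩, by simpa using hz⟩⟩
  simp only [mem_sphere_zero_iff_norm] at hz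
  rw [mem_ball_zero_iff, hz]
  exact hR.2.trans_le hb

/-- Expand `|R² - āz|² - R²|z - a|² = (R² - |a|²)(R² - |z|²)`. The excess over `1` yields both the
bound below by `1` and the logarithmic estimate behind the Blaschke condition. -/
lemma norm_sq_canonicalFactor {R : ℝ} (hR : R ≠ 0) {a z : ℂ} (haz : z ≠ a) :
    ‖canonicalFactor R a z‖ ^ 2 =
      1 + (R ^ 2 - ‖a‖ ^ 2) * (R ^ 2 - ‖z‖ ^ 2) / (R ^ 2 * ‖z - a‖ ^ 2) := by
  have h : ‖z - a‖ ≠ 0 := norm_ne_zero_iff.2 (sub_ne_zero.2 haz)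
  rw [canonicalFactor_apply, norm_div, norm_mul, div_pow, mul_pow, norm_real, Real.norm_eq_abs,
    sq_abs, eq_comm, ← div_self (mul_ne_zero (pow_ne_zero 2 hR) (pow_ne_zero 2 h)), ← add_div]
  congr 1
  simp only [← normSq_eq_norm_sq, normSq_apply, sub_re, sub_im, mul_re, mul_im, conj_re, conj_im,
    ← ofReal_pow, ofReal_re, ofReal_im]
  ring

lemma one_le_norm_canonicalFactor {R : ℝ} {a z : ℂ} (ha : a ∈ ball (0 : ℂ) R)
    (hz : z ∈ closedBall (0 : ℂ) R) (haz : z ≠ a) : 1 ≤ ‖canonicalFactor R a z‖ := by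
  have hR := pos_of_mem_ball ha
  rw [mem_ball_zero_iff] at ha
  rw [mem_closedBall_zero_iff] at hz
  rw [← one_le_sq_iff₀ (norm_nonneg _), norm_sq_canonicalFactor hR.ne' haz]
  have h1 : ‖a‖ ^ 2 ≤ R ^ 2 := by gcongr
  have h2 : ‖z‖ ^ 2 ≤ R ^ 2 := by gcongr
  have : 0 ≤ (R ^ 2 - ‖a‖ ^ 2) * (R ^ 2 - ‖z‖ ^ 2) / (R ^ 2 * ‖z - a‖ ^ 2) :=
    div_nonneg (mul_nonneg (by linarith) (by linarith)) (by positivity)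
  linarith

/-- Dividing `G` by the finite Blaschke product of its zeros in a disc of radius `R`. -/
lemma exists_zeroFree (hG : DifferentiableOn ℂ G (ball 0 1))
    (h0 : ∃ z ∈ ball (0 : ℂ) 1, G z ≠ 0) {R : ℝ} (hR0 : 0 < R) (hR1 : R < 1)
    (hR : ∀ z ∈ sphere (0 : ℂ) R, G z ≠ 0) :
    ∃ h : ℂ → ℂ, AnalyticOnNhd ℂ h (closedBall 0 R) ∧ (∀ z ∈ closedBall (0 : ℂ) R, h z ≠ 0) ∧
      (∀ z ∈ sphere (0 : ℂ) R, ‖h z‖ = ‖G z‖) ∧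
      ∀ z ∈ ball (0 : ℂ) R, G z ≠ 0 → ∀ S : Finset (ZeroIndex G),
        (∀ i ∈ S, zeros G i ∈ ball (0 : ℂ) R) →
        (∏ i ∈ S, ‖canonicalFactor R (zeros G i) z‖) * ‖G z‖ ≤ ‖h z‖ := by
  classical
  have hsub : closedBall (0 : ℂ) R ⊆ ball 0 1 := closedBall_subset_ball hR1
  have hA : AnalyticOnNhd ℂ G (closedBall 0 R) :=
    (analyticOnNhd_of_differentiableOn hG).mono hsub
  have hord : ∀ z ∈ closedBall (0 : ℂ) R,
      meromorphicOrderAt G z = ((analyticOrderNatAt G z : ℤ) : WithTop ℤ) := fun z hz => by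
    rw [(hA z hz).meromorphicOrderAt_eq,
      ← Nat.cast_analyticOrderNatAt (analyticOrderAt_ne_top hG h0 (hsub hz))]
    rfl
  obtain ⟨h, D⟩ := hA.meromorphicOn.exists_ecanonicalDecomp fun u => by
    rw [hord u u.2]; simp
  have hord0 : ∀ z ∈ closedBall (0 : ℂ) R, G z ≠ 0 → meromorphicOrderAt G z = 0 := fun z hz hz0 => by
    rw [(hA z hz).meromorphicOrderAt_eq, (hA z hz).analyticOrderAt_eq_zero.2 hz0]
    rfl
  have hlog : ∀ z ∈ closedBall (0 : ℂ) R, G z ≠ 0 → Real.log ‖h z‖ =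
      (∑ᶠ a, (MeromorphicOn.divisor G (ball 0 R) a) * Real.log ‖canonicalFactor R a z‖)
        + Real.log ‖G z‖ := fun z hz hz0 => by
    rw [D.log_norm_eq hz (hord0 z hz hz0) hR0,
      (hA z hz).meromorphicTrailingCoeffAt_of_ne_zero hz0]
    -- The decomposition also has factors for zeros on the boundary circle; by the choice of `R`
    -- there are none.
    have : ∀ i, (MeromorphicOn.divisor G (sphere 0 R) i : ℝ) * Real.log ‖z - i‖ = 0 := fun i => by
      by_cases hi : i ∈ sphere (0 : ℂ) R
      · rw [MeromorphicOn.divisor_apply (hA.meromorphicOn.mono_set sphere_subset_closedBall) hi,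
          hord0 i (sphere_subset_closedBall hi) (hR i hi)]
        simp
      · rw [Function.locallyFinsuppWithin.apply_eq_zero_of_notMem _ hi]
        simp
    simp [this]
  refine ⟨h, D.analyticOnNhd, D.ne_zero, fun z hz => ?_, fun z hz hz0 S hS => ?_⟩
  · have hzc := sphere_subset_closedBall hz
    have h1 := hlog z hzc (hR z hz)
    have h2 : ∀ a, (MeromorphicOn.divisor G (ball 0 R) a : ℝ) *
        Real.log ‖canonicalFactor R a z‖ = 0 := fun a => by
      by_cases ha : a ∈ ball (0 : ℂ) R
      · rw [norm_canonicalFactor_eval_circle_eq_one ha hz]; simp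
      · rw [Function.locallyFinsuppWithin.apply_eq_zero_of_notMem _ ha]
        simp
    simp only [h2, finsum_zero, zero_add] at h1
    exact Real.log_injOn_pos (norm_pos_iff.2 (D.ne_zero z hzc)) (norm_pos_iff.2 (hR z hz)) h1
  · have hzc := ball_subset_closedBall hz
    have hdiv : ∀ a ∈ ball (0 : ℂ) R, MeromorphicOn.divisor G (ball 0 R) a =
        analyticOrderNatAt G a := fun a ha => by
      rw [MeromorphicOn.divisor_apply (hA.meromorphicOn.mono_set ball_subset_closedBall) ha,
        hord a (ball_subset_closedBall ha)]
      rfl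
    have hne : ∀ a, G a = 0 → z ≠ a := fun a ha h => hz0 (h ▸ ha)
    have hfin := hA.meromorphicOn.divisor_ball_support_finite
    have hpos : ∀ a, 0 ≤ (MeromorphicOn.divisor G (ball 0 R) a : ℝ) *
        Real.log ‖canonicalFactor R a z‖ := fun a => by
      by_cases ha : a ∈ ball (0 : ℂ) R
      · rw [hdiv a ha]
        by_cases ha0 : G a = 0
        · have := Real.log_nonneg (one_le_norm_canonicalFactor ha hzc (hne a ha0))
          push_cast
          positivity
        · have : analyticOrderNatAt G a = 0 := by
            rw [analyticOrderNatAt, (hA a (ball_subset_closedBall ha)).analyticOrderAt_eq_zero.2 ha0]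
            rfl
          simp [this]
      · rw [Function.locallyFinsuppWithin.apply_eq_zero_of_notMem _ ha]
        simp
    have hcf : ∀ i ∈ S, 1 ≤ ‖canonicalFactor R (zeros G i) z‖ := fun i hi =>
      one_le_norm_canonicalFactor (hS i hi) hzc (hne _ (map_zeros i))
    have hGz := norm_pos_iff.2 hz0
    have hprod : 0 < ∏ i ∈ S, ‖canonicalFactor R (zeros G i) z‖ :=
      Finset.prod_pos fun i hi => zero_lt_one.trans_le (hcf i hi)
    rw [← Real.log_le_log_iff (by positivity) (norm_pos_iff.2 (D.ne_zero z hzc)),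
      hlog z hzc hz0, Real.log_mul hprod.ne' hGz.ne',
      Real.log_prod fun i hi => (zero_lt_one.trans_le (hcf i hi)).ne']
    gcongr
    rw [finsum_eq_sum_of_support_subset (s := hfin.toFinset) _ (by
      intro a ha; simp only [Finite.coe_toFinset, Function.mem_support] at ha ⊢
      intro h; simp [h] at ha),
      Finset.sum_comp (fun a => Real.log ‖canonicalFactor R a z‖) (zeros G)]
    -- Grouped by position, `S` uses each zero at most as often as its order, which is the value of
    -- the divisor; all remaining terms are nonnegative.
    refine (Finset.sum_le_sum (g := fun a => (MeromorphicOn.divisor G (ball 0 R) a : ℝ) *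
        Real.log ‖canonicalFactor R a z‖) fun a ha => ?_).trans
      (Finset.sum_le_sum_of_subset_of_nonneg ?_ fun a _ _ => hpos a)
    · obtain ⟨i, hi, rfl⟩ := Finset.mem_image.1 ha
      rw [hdiv _ (hS i hi), nsmul_eq_mul]
      refine mul_le_mul_of_nonneg_right ?_ (Real.log_nonneg (hcf i hi))
      exact_mod_cast card_filter_zeros_le S _
    · intro a ha
      obtain ⟨i, hi, rfl⟩ := Finset.mem_image.1 ha
      simp only [Finite.mem_toFinset, Function.mem_support]
      rw [hdiv _ (hS i hi)]
      exact_mod_cast Nat.ne_zero_of_lt i.2.2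

end HardyOrlicz

/-! ### Infinite Blaschke products and the holomorphic quotient. -/

namespace HardyOrlicz
open Metric Set MeasureTheory Filter Topology Complex

/-- The two expressions are inverse up to a unimodular constant. At `z = a` both sides are `0`,
since division by zero gives `0`. -/
lemma norm_blaschkeFactor (a z : ℂ) : ‖blaschkeFactor a z‖ = ‖canonicalFactor 1 a z‖⁻¹ := by
  rw [blaschkeFactor, canonicalFactor_apply, ← norm_inv, inv_div]
  split_ifs with h
  · simp [h]
  · have : ‖(‖a‖ / a : ℂ)‖ = 1 := by simp [h]
    rw [norm_mul, this, one_mul, norm_div, norm_div, norm_sub_rev]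
    simp

lemma norm_blaschkeFactor_le_one {a z : ℂ} (ha : a ∈ ball (0 : ℂ) 1) (hz : z ∈ ball (0 : ℂ) 1) :
    ‖blaschkeFactor a z‖ ≤ 1 := by
  rw [norm_blaschkeFactor]
  rcases eq_or_ne z a with rfl | h
  · simp
  · exact inv_le_one_of_one_le₀ (one_le_norm_canonicalFactor ha (ball_subset_closedBall hz) h)

lemma one_sub_conj_mul_ne_zero {a z : ℂ} (ha : a ∈ ball (0 : ℂ) 1) (hz : z ∈ ball (0 : ℂ) 1) :
    1 - conj a * z ≠ 0 := by
  intro h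
  rw [sub_eq_zero] at h
  rw [mem_ball_zero_iff] at ha hz
  have h1 : ‖conj a * z‖ < 1 := by
    rw [norm_mul, RCLike.norm_conj]
    exact mul_lt_one_of_nonneg_of_lt_one_left (norm_nonneg _) ha hz.le
  rw [← h] at h1
  simp at h1

/-- For `a ≠ 0` the constant `|a| / a` makes `1 - |a|` split off from the numerator of the
difference. This gives absolute convergence of the product under the Blaschke condition. -/
lemma norm_blaschkeFactor_sub_one_le {a z : ℂ} (ha : a ∈ ball (0 : ℂ) 1)
    (hz : z ∈ ball (0 : ℂ) 1) :
    ‖blaschkeFactor a z - 1‖ ≤ (1 - ‖a‖) * ((1 + ‖z‖) / (1 - ‖z‖)) := by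
  have h0 := one_sub_conj_mul_ne_zero ha hz
  rw [mem_ball_zero_iff] at ha hz
  have hz' : 0 < 1 - ‖z‖ := by linarith
  rw [blaschkeFactor]
  split_ifs with h
  · subst h
    simp only [norm_zero, sub_zero, one_mul]
    refine (norm_sub_le _ _).trans ?_
    rw [norm_one, le_div_iff₀ hz']
    nlinarith [norm_nonneg z]
  · have h1 : (‖a‖ / a : ℂ) * ((a - z) / (1 - conj a * z)) - 1 =
        -((1 - ‖a‖ : ℝ) * (a + ‖a‖ * z)) / (a * (1 - conj a * z)) := by
      have h2 : conj a * a = (‖a‖ : ℂ) ^ 2 := by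
        rw [mul_comm, Complex.mul_conj, normSq_eq_norm_sq]; push_cast; rfl
      rw [div_mul_div_comm, div_sub_one (mul_ne_zero h h0)]
      congr 1
      push_cast
      linear_combination z * h2
    have hap : 0 < ‖a‖ := norm_pos_iff.2 h
    have ha' : 0 ≤ 1 - ‖a‖ := by linarith
    rw [h1, norm_div, norm_neg, norm_mul, norm_mul, norm_real, Real.norm_of_nonneg ha',
      mul_div_assoc]
    refine mul_le_mul_of_nonneg_left ?_ ha'
    have h3 : ‖a + ‖a‖ * z‖ ≤ ‖a‖ * (1 + ‖z‖) := by
      refine (norm_add_le _ _).trans_eq ?_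
      rw [norm_mul, norm_real, norm_norm]; ring
    have h4 : 1 - ‖z‖ ≤ ‖1 - conj a * z‖ := by
      have h5 := norm_sub_norm_le (1 : ℂ) (conj a * z)
      rw [norm_one, norm_mul, RCLike.norm_conj] at h5
      have : ‖a‖ * ‖z‖ ≤ ‖z‖ := mul_le_of_le_one_left (norm_nonneg _) ha.le
      linarith
    calc ‖a + ‖a‖ * z‖ / (‖a‖ * ‖1 - conj a * z‖)
        ≤ (‖a‖ * (1 + ‖z‖)) / (‖a‖ * (1 - ‖z‖)) := by gcongr
      _ = (1 + ‖z‖) / (1 - ‖z‖) := mul_div_mul_left _ _ hap.ne'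

/-- Apply `log x ≥ 1 - 1 / x` to the squared norm. With `N = (1 - |a|²)(1 - |z|²)` the right side is
`N / (|z - a|² + N)`, whose denominator is at most `4`; the square in the logarithm turns `4` into
`8`. -/
lemma one_sub_norm_le_log_canonicalFactor {a z : ℂ} (ha : a ∈ ball (0 : ℂ) 1)
    (hz : z ∈ ball (0 : ℂ) 1) (haz : z ≠ a) :
    (1 - ‖a‖) * ((1 - ‖z‖ ^ 2) / 8) ≤ Real.log ‖canonicalFactor 1 a z‖ := by
  have h1 := norm_sq_canonicalFactor one_ne_zero haz
  have h2 := one_le_norm_canonicalFactor ha (ball_subset_closedBall hz) haz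
  have h3 : 0 < ‖z - a‖ := norm_pos_iff.2 (sub_ne_zero.2 haz)
  rw [mem_ball_zero_iff] at ha hz
  have hd : ‖z - a‖ ^ 2 ≤ 2 * (‖a‖ ^ 2 + ‖z‖ ^ 2) := by
    have h4 := norm_sub_le z a
    have h5 : ‖z - a‖ ^ 2 ≤ (‖z‖ + ‖a‖) ^ 2 := by gcongr
    nlinarith [sq_nonneg (‖z‖ - ‖a‖)]
  have ha0 := norm_nonneg a
  have hz0 := norm_nonneg z
  set A := ‖a‖
  set Z := ‖z‖
  set N := (1 - A ^ 2) * (1 - Z ^ 2) with hN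
  have hA : 0 < 1 - A ^ 2 := by nlinarith
  have hZ : 0 < 1 - Z ^ 2 := by nlinarith
  have hNpos : 0 < N := mul_pos hA hZ
  have hlog : Real.log (‖canonicalFactor 1 a z‖ ^ 2) = 2 * Real.log ‖canonicalFactor 1 a z‖ := by
    rw [Real.log_pow]; norm_num
  have hx := Real.one_sub_inv_le_log_of_pos (x := ‖canonicalFactor 1 a z‖ ^ 2) (by positivity)
  have h6 : 1 - (‖canonicalFactor 1 a z‖ ^ 2)⁻¹ = N / (‖z - a‖ ^ 2 + N) := by
    rw [h1]
    simp only [one_pow, one_mul, ← hN]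
    field_simp
    ring
  have h7 : (1 - A) * ((1 - Z ^ 2) / 4) ≤ N / (‖z - a‖ ^ 2 + N) := by
    rw [le_div_iff₀ (by positivity)]
    have h8 : ‖z - a‖ ^ 2 + N ≤ 4 := by
      have : N ≤ 1 - A ^ 2 - Z ^ 2 + A ^ 2 * Z ^ 2 := by rw [hN]; ring_nf; rfl
      nlinarith
    have h9 : (1 - A) * (1 - Z ^ 2) ≤ N := by
      rw [hN]; gcongr; nlinarith
    have h10 : 0 ≤ (1 - A) * (1 - Z ^ 2) := mul_nonneg (by linarith) hZ.le
    nlinarith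
  rw [h6, hlog] at hx
  linarith

variable {ι : Type} {a : ι → ℂ}

lemma summable_of_prod_canonicalFactor_le (ha : ∀ i, a i ∈ ball (0 : ℂ) 1) {z : ℂ}
    (hz : z ∈ ball (0 : ℂ) 1) (haz : ∀ i, z ≠ a i) {M : ℝ}
    (hM : ∀ S : Finset ι, ∏ i ∈ S, ‖canonicalFactor 1 (a i) z‖ ≤ M) :
    Summable fun i => 1 - ‖a i‖ := by
  have hz' : 0 < (1 - ‖z‖ ^ 2) / 8 := by
    rw [mem_ball_zero_iff] at hz
    nlinarith [norm_nonneg z]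
  rw [← summable_mul_right_iff hz'.ne']
  refine summable_of_sum_le (c := Real.log M) (fun i => ?_) fun S => ?_
  · have := mem_ball_zero_iff.1 (ha i)
    exact mul_nonneg (by linarith) hz'.le
  · have h1 : ∀ i, 0 < ‖canonicalFactor 1 (a i) z‖ := fun i =>
      zero_lt_one.trans_le (one_le_norm_canonicalFactor (ha i) (ball_subset_closedBall hz) (haz i))
    refine (Finset.sum_le_sum fun i _ =>
      one_sub_norm_le_log_canonicalFactor (ha i) hz (haz i)).trans ?_
    rw [← Real.log_prod fun i _ => (h1 i).ne']
    exact Real.log_le_log (Finset.prod_pos fun i _ => h1 i) (hM S)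

lemma differentiableOn_blaschkeFactor {b : ℂ} (hb : b ∈ ball (0 : ℂ) 1) :
    DifferentiableOn ℂ (blaschkeFactor b) (ball 0 1) := by
  unfold blaschkeFactor
  split_ifs with h
  · fun_prop
  · have hd : DifferentiableOn ℂ (fun z => 1 - conj b * z) (ball 0 1) := by fun_prop
    exact ((differentiableOn_id.const_sub b).div hd fun z hz =>
      one_sub_conj_mul_ne_zero hb hz).const_mul _

lemma summable_norm_blaschkeFactor_sub_one (ha : ∀ i, a i ∈ ball (0 : ℂ) 1)
    (hs : Summable fun i => 1 - ‖a i‖) {z : ℂ} (hz : z ∈ ball (0 : ℂ) 1) :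
    Summable fun i => ‖blaschkeFactor (a i) z - 1‖ :=
  Summable.of_nonneg_of_le (fun _ => norm_nonneg _)
    (fun i => norm_blaschkeFactor_sub_one_le (ha i) hz) (hs.mul_right _)

lemma multipliable_blaschkeFactor (ha : ∀ i, a i ∈ ball (0 : ℂ) 1)
    (hs : Summable fun i => 1 - ‖a i‖) {z : ℂ} (hz : z ∈ ball (0 : ℂ) 1) :
    Multipliable fun i => blaschkeFactor (a i) z := by
  simpa using multipliable_one_add_of_summable (summable_norm_blaschkeFactor_sub_one ha hs hz)

lemma blaschkeProduct_ne_zero (ha : ∀ i, a i ∈ ball (0 : ℂ) 1)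
    (hs : Summable fun i => 1 - ‖a i‖) {z : ℂ} (hz : z ∈ ball (0 : ℂ) 1) (haz : ∀ i, z ≠ a i) :
    blaschkeProduct a z ≠ 0 := by
  have h := tprod_one_add_ne_zero_of_summable (f := fun i => blaschkeFactor (a i) z - 1)
    (fun i => ?_) (summable_norm_blaschkeFactor_sub_one ha hs hz)
  · simpa [blaschkeProduct] using h
  · rw [add_sub_cancel, ← norm_ne_zero_iff, norm_blaschkeFactor]
    exact inv_ne_zero (zero_lt_one.trans_le
      (one_le_norm_canonicalFactor (ha i) (ball_subset_closedBall hz) (haz i))).ne'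

lemma tendsto_norm_prod_blaschkeFactor (ha : ∀ i, a i ∈ ball (0 : ℂ) 1)
    (hs : Summable fun i => 1 - ‖a i‖) {z : ℂ} (hz : z ∈ ball (0 : ℂ) 1) :
    Tendsto (fun S : Finset ι => ∏ i ∈ S, ‖blaschkeFactor (a i) z‖) atTop
      (𝓝 ‖blaschkeProduct a z‖) := by
  have h : Tendsto (fun S : Finset ι => ∏ i ∈ S, blaschkeFactor (a i) z) atTop
      (𝓝 (blaschkeProduct a z)) := (multipliable_blaschkeFactor ha hs hz).hasProd
  simpa only [norm_prod] using h.norm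

lemma norm_blaschkeProduct_le_one (ha : ∀ i, a i ∈ ball (0 : ℂ) 1)
    (hs : Summable fun i => 1 - ‖a i‖) {z : ℂ} (hz : z ∈ ball (0 : ℂ) 1) :
    ‖blaschkeProduct a z‖ ≤ 1 :=
  le_of_tendsto' (tendsto_norm_prod_blaschkeFactor ha hs hz) fun _ =>
    Finset.prod_le_one (fun _ _ => norm_nonneg _) fun i _ => norm_blaschkeFactor_le_one (ha i) hz

lemma differentiableOn_blaschkeProduct (ha : ∀ i, a i ∈ ball (0 : ℂ) 1)
    (hs : Summable fun i => 1 - ‖a i‖) :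
    DifferentiableOn ℂ (blaschkeProduct a) (ball 0 1) := by
  -- The bound on the factors is uniform only on smaller discs, so holomorphy is proved there first.
  have hcov : ∀ r < (1 : ℝ), DifferentiableOn ℂ (blaschkeProduct a) (ball 0 r) := fun r hr => by
    have hsub : ball (0 : ℂ) r ⊆ ball 0 1 := ball_subset_ball hr.le
    have h1 : HasProdLocallyUniformlyOn (fun i z => 1 + (blaschkeFactor (a i) z - 1))
        (fun z => ∏' i, (1 + (blaschkeFactor (a i) z - 1))) (ball 0 r) := by
      refine Summable.hasProdLocallyUniformlyOn_one_add
        (u := fun i => (1 - ‖a i‖) * ((1 + r) / (1 - r))) isOpen_ball (hs.mul_right _)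
        (.of_forall fun i z hz => ?_) fun i => ?_
      · refine (norm_blaschkeFactor_sub_one_le (ha i) (hsub hz)).trans ?_
        have h2 := mem_ball_zero_iff.1 (ha i)
        have h3 := mem_ball_zero_iff.1 hz
        have h4 := norm_nonneg z
        have : (0 : ℝ) < 1 - r := by linarith
        have : (0 : ℝ) ≤ 1 - ‖a i‖ := by linarith
        have : (0 : ℝ) ≤ 1 + r := by linarith
        gcongr
      · exact ((differentiableOn_blaschkeFactor (ha i)).mono hsub).continuousOn.sub continuousOn_const
    simp only [add_sub_cancel] at h1
    refine (hasProdLocallyUniformlyOn_iff_tendstoLocallyUniformlyOn.1 h1).differentiableOn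
      (.of_forall fun S => ?_) isOpen_ball
    exact DifferentiableOn.fun_finsetProd fun i _ =>
      (differentiableOn_blaschkeFactor (ha i)).mono hsub
  intro z hz
  obtain ⟨r, hr, hr1⟩ := exists_between (mem_ball_zero_iff.1 hz)
  exact (((hcov r hr1).differentiableAt (isOpen_ball.mem_nhds (by simpa using hr)))).differentiableWithinAt

variable {G : ℂ → ℂ}

lemma exists_blaschkeFactor_eq {w : ℂ} (hw : w ∈ ball (0 : ℂ) 1) :
    ∃ u : ℂ → ℂ, DifferentiableOn ℂ u (ball 0 1) ∧ u w ≠ 0 ∧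
      ∀ z, blaschkeFactor w z = (z - w) * u z := by
  rcases eq_or_ne w 0 with rfl | h
  · exact ⟨fun _ => 1, by fun_prop, one_ne_zero, fun z => by simp [blaschkeFactor]⟩
  · have hd : DifferentiableOn ℂ (fun z => 1 - conj w * z) (ball 0 1) := by fun_prop
    refine ⟨fun z => -(‖w‖ / w) / (1 - conj w * z), ?_, ?_, fun z => ?_⟩
    · exact (differentiableOn_const _).div hd fun z hz => one_sub_conj_mul_ne_zero hw hz
    · exact div_ne_zero (by simp [h]) (one_sub_conj_mul_ne_zero hw hw)
    · rw [blaschkeFactor, if_neg h]; ring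

lemma finite_fiber_zeros (w : ℂ) : {i : ZeroIndex G | zeros G i = w}.Finite := by
  refine Finite.of_finite_image (f := fun i => i.1.2)
    ((finite_Iio (analyticOrderNatAt G w)).subset ?_) ?_
  · rintro _ ⟨i, hi, rfl⟩
    simp only [mem_ofPred_eq] at hi
    subst hi
    exact i.2.2
  · intro i hi j hj hij
    simp only [mem_ofPred_eq] at hi hj
    exact Subtype.ext (Prod.ext (hi.trans hj.symm) hij)

/-- Near each point, the Blaschke product of the zeros of `G` vanishes at most to the same order
as `G`. -/
lemma exists_blaschkeProduct_eq_pow_mul (hs : Summable fun i => 1 - ‖zeros G i‖) {w : ℂ}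
    (hw : w ∈ ball (0 : ℂ) 1) :
    ∃ m ≤ analyticOrderNatAt G w, ∃ V : ℂ → ℂ, AnalyticAt ℂ V w ∧ V w ≠ 0 ∧
      ∀ᶠ z in 𝓝 w, blaschkeProduct (zeros G) z = (z - w) ^ m * V z := by
  classical
  -- Only the finitely many factors indexed by `S` vanish at `w`; the product over the complement is
  -- holomorphic and nonzero there.
  set S := (finite_fiber_zeros (G := G) w).toFinset with hS
  have hmemS : ∀ i, i ∈ S ↔ zeros G i = w := fun i => by simp [hS]
  obtain ⟨u, hu, huw, hbu⟩ := exists_blaschkeFactor_eq hw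
  set a' : ((S : Set (ZeroIndex G))ᶜ : Set (ZeroIndex G)) → ℂ := fun i => zeros G i with ha'
  have hab : ∀ i, a' i ∈ ball (0 : ℂ) 1 := fun i => zeros_mem_ball _
  have hs' : Summable fun i => 1 - ‖a' i‖ := hs.subtype _
  have hball : ball (0 : ℂ) 1 ∈ 𝓝 w := isOpen_ball.mem_nhds hw
  refine ⟨S.card, ?_, fun z => u z ^ S.card * blaschkeProduct a' z, ?_, ?_, ?_⟩
  · have := card_filter_zeros_le S w
    rwa [Finset.filter_true_of_mem fun i hi => (hmemS i).1 hi] at this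
  · exact ((hu.analyticAt hball).pow _).mul
      ((differentiableOn_blaschkeProduct hab hs').analyticAt hball)
  · refine mul_ne_zero (pow_ne_zero _ huw) (blaschkeProduct_ne_zero hab hs' hw fun i h => ?_)
    exact i.2 ((hmemS i).2 h.symm)
  · filter_upwards [hball] with z hz
    have h1 := Multipliable.tprod_mul_tprod_compl (s := (S : Set (ZeroIndex G)))
      (f := fun i => blaschkeFactor (zeros G i) z) (S.multipliable _)
      (multipliable_blaschkeFactor hab hs' hz)
    rw [blaschkeProduct, ← h1, ← mul_assoc, ← mul_pow]
    congr 1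
    rw [Finset.tprod_subtype' S fun i => blaschkeFactor (zeros G i) z, ← hbu]
    exact Finset.prod_eq_pow_card fun i hi => by rw [(hmemS i).1 hi]

/-- The quotient of `G` by the Blaschke product of its zeros is holomorphic. -/
lemma exists_eq_blaschkeProduct_mul (hG : DifferentiableOn ℂ G (ball 0 1))
    (h0 : ∃ z ∈ ball (0 : ℂ) 1, G z ≠ 0) (hs : Summable fun i => 1 - ‖zeros G i‖) :
    ∃ F : ℂ → ℂ, DifferentiableOn ℂ F (ball 0 1) ∧
      ∀ z ∈ ball (0 : ℂ) 1, G z = blaschkeProduct (zeros G) z * F z := by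
  set B := blaschkeProduct (zeros G) with hB
  have hGA := analyticOnNhd_of_differentiableOn hG
  have hBA : AnalyticOnNhd ℂ B (ball 0 1) :=
    (differentiableOn_blaschkeProduct (fun i => zeros_mem_ball i) hs).analyticOnNhd isOpen_ball
  have hmer : MeromorphicOn (G / B) (ball 0 1) := fun z hz =>
    (hGA z hz).meromorphicAt.div (hBA z hz).meromorphicAt
  -- The meromorphic normal form fills in the removable singularities of the quotient.
  set F := toMeromorphicNFOn (G / B) (ball 0 1)
  have hBne : ∀ w ∈ ball (0 : ℂ) 1, ∀ᶠ z in 𝓝[≠] w, B z ≠ 0 := fun w hw => by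
    obtain ⟨m, -, V, hV, hVw, hBV⟩ := exists_blaschkeProduct_eq_pow_mul hs hw
    filter_upwards [hBV.filter_mono nhdsWithin_le_nhds,
      (hV.continuousAt.eventually_ne hVw).filter_mono nhdsWithin_le_nhds,
      self_mem_nhdsWithin] with z h1 h2 h3
    rw [hB, h1]
    exact mul_ne_zero (pow_ne_zero _ (sub_ne_zero.2 h3)) h2
  have hFA : AnalyticOnNhd ℂ F (ball 0 1) := fun w hw => by
    rw [← (meromorphicNFOn_toMeromorphicNFOn (G / B) (ball 0 1)
      hw).meromorphicOrderAt_nonneg_iff_analyticAt, meromorphicOrderAt_toMeromorphicNFOn hmer hw,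
      MeromorphicAt.meromorphicOrderAt_nonneg_iff (hmer w hw)]
    obtain ⟨m, hm, V, hV, hVw, hBV⟩ := exists_blaschkeProduct_eq_pow_mul hs hw
    obtain ⟨g, hg, -, hGg⟩ := (hGA w hw).analyticOrderAt_ne_top.1 (analyticOrderAt_ne_top hG h0 hw)
    refine ⟨fun z => (z - w) ^ (analyticOrderNatAt G w - m) * g z / V z,
      (((analyticAt_id.sub analyticAt_const).pow _).mul hg).div hV hVw, ?_⟩
    filter_upwards [hBV.filter_mono nhdsWithin_le_nhds, hGg.filter_mono nhdsWithin_le_nhds,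
      (hV.continuousAt.eventually_ne hVw).filter_mono nhdsWithin_le_nhds,
      self_mem_nhdsWithin] with z h1 h2 h3 h4
    have h5 : z - w ≠ 0 := sub_ne_zero.2 h4
    rw [Pi.div_apply, hB, h1, h2, smul_eq_mul, div_eq_div_iff (by positivity) h3]
    nth_rewrite 1 [← Nat.sub_add_cancel hm]
    ring
  refine ⟨F, hFA.differentiableOn, fun w hw => ?_⟩
  have h1 : G =ᶠ[𝓝[≠] w] fun z => B z * F z := by
    filter_upwards [hBne w hw, hmer.toMeromorphicNFOn_eq_self_on_nhdsNE hw] with z hz1 hz2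
    change G z = B z * toMeromorphicNFOn (G / B) (ball 0 1) z
    rw [hz2, Pi.div_apply, mul_div_cancel₀ _ hz1]
  exact (((hGA w hw).continuousAt.eventuallyEq_nhds_iff_eventuallyEq_nhdsNE
    ((hBA w hw).mul (hFA w hw)).continuousAt).1 h1).eq_of_nhds

end HardyOrlicz

/-! ### Passage to the limit: the Blaschke condition and the means of the quotient. -/

namespace HardyOrlicz
open Metric Set MeasureTheory Filter Topology Complex

variable {Φ : ℝ≥0 → ℝ≥0} {G : ℂ → ℂ} {c : ℝ≥0}

lemma orliczMean_le_one_iff {g : Circle → ℂ} : orliczMean Φ g c ≤ 1 ↔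
    ∫⁻ θ in Ioc 0 (2 * Real.pi), (Φ (‖g (Circle.exp θ)‖₊ / c) : ℝ≥0∞) ≤
      ENNReal.ofReal (2 * Real.pi) := by
  have h : ENNReal.ofReal (2 * Real.pi) ≠ 0 := by
    rw [Ne, ENNReal.ofReal_eq_zero, not_le]; positivity
  rw [orliczMean, ENNReal.inv_mul_le_iff h ENNReal.ofReal_ne_top, mul_one]

/-- A version of Fatou's lemma for Orlicz means. -/
lemma orliczMean_le_one_of_eventually_lt (hΦ : IsGrowthFunction Φ) (hp : IsPowerConvex Φ)
    {f : Circle → ℂ} {g : ℕ → Circle → ℂ} (hg : ∀ n, Continuous (g n))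
    (hfg : ∀ ζ, ∀ y < ‖f ζ‖, ∀ᶠ n in atTop, y < ‖g n ζ‖) (hc : 0 < c)
    (h : ∀ n, orliczMean Φ (g n) c ≤ 1) : orliczMean Φ f c ≤ 1 := by
  simp only [orliczMean_le_one_iff] at h ⊢
  have hmeas : ∀ n, Measurable fun θ : ℝ => (Φ (‖g n (Circle.exp θ)‖₊ / c) : ℝ≥0∞) := fun n =>
    (hΦ.monotone.measurable.comp (((hg n).comp Circle.exp.continuous).nnnorm.measurable.div_const
      c)).coe_nnreal_ennreal
  refine (lintegral_mono fun θ => ?_).trans ((lintegral_liminf_le (u := atTop) hmeas).trans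
    (liminf_le_of_frequently_le' (Eventually.of_forall h).frequently))
  refine le_of_forall_lt_imp_le_of_dense fun b hb => ?_
  have hf : 0 < ‖f (Circle.exp θ)‖₊ / c := by
    rw [pos_iff_ne_zero]
    intro h0
    rw [h0, hΦ.map_zero] at hb
    simp at hb
  have hcont : ContinuousAt (fun t => (Φ t : ℝ≥0∞)) (‖f (Circle.exp θ)‖₊ / c) :=
    (ENNReal.continuous_coe.continuousAt).comp (continuousAt_of_isPowerConvex hΦ.monotone hp hf)
  have : (𝓝[<] (‖f (Circle.exp θ)‖₊ / c)).NeBot := nhdsLT_neBot_of_exists_lt ⟨0, hf⟩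
  -- Only asymptotic lower bounds for `‖g n‖` are available, so move slightly to the left of `‖f‖ /
  -- c`, keeping `Φ` above `b` by continuity.
  obtain ⟨s, hs, hbs⟩ := (((hcont.eventually (lt_mem_nhds hb)).filter_mono
    (nhdsWithin_le_nhds (s := Iio (‖f (Circle.exp θ)‖₊ / c)))).and self_mem_nhdsWithin).exists
  rw [lt_div_iff₀ hc] at hbs
  refine le_liminf_of_le (by isBoundedDefault) ?_
  filter_upwards [hfg (Circle.exp θ) (s * c : ℝ≥0) (by exact_mod_cast hbs)] with n hn
  refine hs.le.trans ?_
  have : s ≤ ‖g n (Circle.exp θ)‖₊ / c := by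
    rw [le_div_iff₀ hc]
    exact_mod_cast hn.le
  exact_mod_cast hΦ.monotone this

/-- Dividing out the zeros in a disc does not increase the Orlicz means of a Hardy function. -/
lemma exists_zeroFree_orliczMean_le_one (hΦ : Monotone Φ) (hp : IsPowerConvex Φ)
    (hG : DifferentiableOn ℂ G (ball 0 1)) (h0 : ∃ z ∈ ball (0 : ℂ) 1, G z ≠ 0)
    {R : ℝ} (hR0 : 0 < R) (hR1 : R < 1) (hR : ∀ z ∈ sphere (0 : ℂ) R, G z ≠ 0)
    (hc : ∀ r ∈ Ico (0 : ℝ) 1, orliczMean Φ (dilate G r) c ≤ 1) :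
    ∃ h : ℂ → ℂ, ContinuousOn h (ball 0 R) ∧
      (∀ r ∈ Ico 0 R, orliczMean Φ (dilate h r) c ≤ 1) ∧
      (∀ z ∈ ball (0 : ℂ) R, (Φ (‖h z‖₊ / c) : ℝ) ≤ (R + ‖z‖) / (R - ‖z‖)) ∧
      ∀ z ∈ ball (0 : ℂ) R, G z ≠ 0 → ∀ S : Finset (ZeroIndex G),
        (∀ i ∈ S, zeros G i ∈ ball (0 : ℂ) R) →
        (∏ i ∈ S, ‖canonicalFactor R (zeros G i) z‖) * ‖G z‖ ≤ ‖h z‖ := by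
  obtain ⟨h, hA, hne, hsph, hprod⟩ := exists_zeroFree hG h0 hR0 hR1 hR
  have hharm : InnerProductSpace.HarmonicOnNhd (fun z => Real.log ‖h z‖) (closedBall 0 R) :=
    fun z hz => (hA z hz).harmonicAt_log_norm (hne z hz)
  have hψ := convexOn_expGrowth hΦ hp c
  have hRmean : Real.circleAverage (fun z => expGrowth Φ c (Real.log ‖h z‖)) 0 R ≤ 1 := by
    have h1 := hc R ⟨hR0.le, hR1⟩
    rw [orliczMean_dilate_eq hΦ hp hR0.le (hG.continuousOn.mono
      (sphere_subset_closedBall.trans (closedBall_subset_ball hR1))) hR,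
      ENNReal.ofReal_le_one] at h1
    rwa [Real.circleAverage_congr_sphere (f₂ := fun z => expGrowth Φ c (Real.log ‖G z‖))]
    intro z hz
    rw [abs_of_pos hR0] at hz
    simp only [hsph z hz]
  refine ⟨h, hA.continuousOn.mono ball_subset_closedBall, fun r hr => ?_, fun z hz => ?_, hprod⟩
  · have hsub : sphere (0 : ℂ) r ⊆ closedBall 0 R :=
      sphere_subset_closedBall.trans (closedBall_subset_closedBall hr.2.le)
    rw [orliczMean_dilate_eq hΦ hp hr.1 (hA.continuousOn.mono hsub) fun z hz => hne z (hsub hz),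
      ENNReal.ofReal_le_one]
    exact (circleAverage_convex_comp_harmonic_mono hψ hharm hr.1 hr.2).trans hRmean
  · have h1 := convex_comp_harmonic_le hψ (expGrowth_nonneg Φ c) hharm hz
    rw [expGrowth_log _ _ (hne z (ball_subset_closedBall hz))] at h1
    refine h1.trans (mul_le_of_le_one_right ?_ hRmean)
    have h2 := mem_ball_zero_iff.1 hz
    exact div_nonneg (by positivity) (by linarith)

/-- There are radii tending to `1` on whose circles `G` has no zeros. -/
lemma exists_seq_radius_ne_zero (hG : DifferentiableOn ℂ G (ball 0 1))
    (h0 : ∃ z ∈ ball (0 : ℂ) 1, G z ≠ 0) {a : ℝ} (ha : a < 1) :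
    ∃ R : ℕ → ℝ, (∀ n, R n ∈ Ioo a 1) ∧ (∀ n, ∀ z ∈ sphere (0 : ℂ) (R n), G z ≠ 0) ∧
      Tendsto R atTop (𝓝 1) := by
  obtain ⟨u, -, hu, hu1⟩ := exists_seq_strictMono_tendsto' ha
  choose R hR hR0 using fun n => exists_radius_ne_zero hG h0 (hu n).2 le_rfl
  exact ⟨R, fun n => ⟨(hu n).1.trans (hR n).1, (hR n).2⟩, hR0,
    tendsto_of_tendsto_of_tendsto_of_le_of_le hu1 tendsto_const_nhds (fun n => (hR n).1.le)
      fun n => (hR n).2.le⟩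

/-- There are radii decreasing to `a` on whose circles `G` has no zeros. -/
lemma exists_seq_radius_ne_zero_right (hG : DifferentiableOn ℂ G (ball 0 1))
    (h0 : ∃ z ∈ ball (0 : ℂ) 1, G z ≠ 0) {a : ℝ} (ha : a < 1) :
    ∃ R : ℕ → ℝ, (∀ n, R n ∈ Ioo a 1) ∧ (∀ n, ∀ z ∈ sphere (0 : ℂ) (R n), G z ≠ 0) ∧
      Tendsto R atTop (𝓝 a) := by
  obtain ⟨u, -, hu, hu1⟩ := exists_seq_strictAnti_tendsto' ha
  choose R hR hR0 using fun n => exists_radius_ne_zero hG h0 (hu n).1 (hu n).2.le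
  exact ⟨R, fun n => ⟨(hR n).1, (hR n).2.trans (hu n).2⟩, hR0,
    tendsto_of_tendsto_of_tendsto_of_le_of_le tendsto_const_nhds hu1 (fun n => (hR n).1.le)
      fun n => (hR n).2.le⟩

lemma tendsto_prod_canonicalFactor {R : ℕ → ℝ} (hR : Tendsto R atTop (𝓝 1)) {z : ℂ}
    (hz : G z ≠ 0) (S : Finset (ZeroIndex G)) :
    Tendsto (fun n => ∏ i ∈ S, ‖canonicalFactor (R n) (zeros G i) z‖) atTop
      (𝓝 (∏ i ∈ S, ‖canonicalFactor 1 (zeros G i) z‖)) := by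
  refine tendsto_finsetProd _ fun i _ => Tendsto.norm ?_
  have hne : z - zeros G i ≠ 0 := sub_ne_zero.2 fun h => hz (h ▸ map_zeros i)
  have h1 : Tendsto (fun n => (R n : ℂ)) atTop (𝓝 ((1 : ℝ) : ℂ)) :=
    (continuous_ofReal.tendsto 1).comp hR
  simp only [canonicalFactor_apply]
  exact ((h1.pow 2).sub_const _).div (h1.mul_const _) (by simpa using hne)

lemma eventually_zeros_mem_ball {R : ℕ → ℝ} (hR : Tendsto R atTop (𝓝 1))
    (S : Finset (ZeroIndex G)) : ∀ᶠ n in atTop, ∀ i ∈ S, zeros G i ∈ ball (0 : ℂ) (R n) := by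
  refine S.eventually_all.2 fun i _ => ?_
  filter_upwards [hR.eventually (lt_mem_nhds (mem_ball_zero_iff.1 (zeros_mem_ball i)))] with n hn
  exact mem_ball_zero_iff.2 hn

/-- The zeros of a Hardy function satisfy the Blaschke condition. -/
lemma summable_one_sub_norm_zeros (hΦ : IsGrowthFunction Φ) (hp : IsPowerConvex Φ)
    (hG : DifferentiableOn ℂ G (ball 0 1)) (h0 : ∃ z ∈ ball (0 : ℂ) 1, G z ≠ 0) (hc0 : 0 < c)
    (hc : ∀ r ∈ Ico (0 : ℝ) 1, orliczMean Φ (dilate G r) c ≤ 1) :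
    Summable fun i => 1 - ‖zeros G i‖ := by
  obtain ⟨z, hz, hGz⟩ := id h0
  have hz1 := mem_ball_zero_iff.1 hz
  obtain ⟨R, hR, hR0, hR1⟩ := exists_seq_radius_ne_zero hG h0
    (show (1 + ‖z‖) / 2 < 1 by linarith)
  have hzn := norm_nonneg z
  have hRpos : ∀ n, 0 < R n := fun n => by have := (hR n).1; linarith
  have hzR : ∀ n, z ∈ ball (0 : ℂ) (R n) := fun n => by
    have := (hR n).1
    rw [mem_ball_zero_iff]; linarith
  choose h hcont hmean hbd hprod using fun n =>
    exists_zeroFree_orliczMean_le_one hΦ.monotone hp hG h0 (hRpos n) (hR n).2 (hR0 n) hc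
  -- As `R n > (1 + ‖z‖) / 2`, the Harnack constants `(R n + ‖z‖) / (R n - ‖z‖)` are all at most
  -- this number; unboundedness of `Φ` then bounds `‖h n z‖`.
  obtain ⟨T, hT⟩ := (hΦ.tendsto_atTop.eventually_gt_atTop
    (2 / ((1 - ‖z‖) / 2)).toNNReal).exists
  have hbound : ∀ n, ‖h n z‖ ≤ T * c := fun n => by
    by_contra! hlt
    have h1 : T ≤ ‖h n z‖₊ / c := by
      rw [le_div_iff₀ hc0]; exact_mod_cast hlt.le
    have h2 := hT.trans_le (hΦ.monotone h1)
    have h3 : (2 / ((1 - ‖z‖) / 2)) < (Φ (‖h n z‖₊ / c) : ℝ) := Real.toNNReal_lt_iff_lt_coe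
      (by have : 0 < 1 - ‖z‖ := by linarith
          positivity) |>.1 h2
    have h4 : (R n + ‖z‖) / (R n - ‖z‖) ≤ 2 / ((1 - ‖z‖) / 2) := by
      have := hR n
      apply div_le_div₀ <;> linarith [this.1, this.2]
    linarith [hbd n z (hzR n)]
  refine summable_of_prod_canonicalFactor_le (M := T * c / ‖G z‖) (fun i => zeros_mem_ball i) hz
    (fun i hi => hGz (hi ▸ map_zeros i)) fun S => ?_
  rw [le_div_iff₀ (norm_pos_iff.2 hGz)]
  refine le_of_tendsto ((tendsto_prod_canonicalFactor hR1 hGz S).mul_const _) ?_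
  filter_upwards [eventually_zeros_mem_ball hR1 S] with n hn
  exact (hprod n z (hzR n) hGz S hn).trans (hbound n)

lemma continuous_dilate {f : ℂ → ℂ} {r R : ℝ} (hf : ContinuousOn f (ball 0 R))
    (hr : r ∈ Ico 0 R) : Continuous (dilate f r) := by
  refine hf.comp_continuous (by fun_prop) fun ζ => ?_
  have h : ‖(ζ : ℂ)‖ = 1 := Circle.norm_coe ζ
  simp [abs_of_nonneg hr.1, h, hr.2]

/-- Dividing by the Blaschke product of the zeros does not increase the Orlicz means. -/
lemma orliczMean_dilate_quotient_le_one (hΦ : IsGrowthFunction Φ) (hp : IsPowerConvex Φ)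
    (hG : DifferentiableOn ℂ G (ball 0 1)) (h0 : ∃ z ∈ ball (0 : ℂ) 1, G z ≠ 0) (hc0 : 0 < c)
    (hc : ∀ r ∈ Ico (0 : ℝ) 1, orliczMean Φ (dilate G r) c ≤ 1)
    {F : ℂ → ℂ} (hF : DifferentiableOn ℂ F (ball 0 1))
    (hGF : ∀ z ∈ ball (0 : ℂ) 1, G z = blaschkeProduct (zeros G) z * F z) :
    ∀ r ∈ Ico (0 : ℝ) 1, orliczMean Φ (dilate F r) c ≤ 1 := by
  have hs := summable_one_sub_norm_zeros hΦ hp hG h0 hc0 hc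
  -- Circles without zeros come first: the comparison of `h n` with `G` requires `G z ≠ 0`.
  have hgood : ∀ r ∈ Ico (0 : ℝ) 1, (∀ z ∈ sphere (0 : ℂ) r, G z ≠ 0) →
      orliczMean Φ (dilate F r) c ≤ 1 := fun r hr hr0 => by
    obtain ⟨R, hR, hR0, hR1⟩ := exists_seq_radius_ne_zero hG h0 hr.2
    choose h hcont hmean hbd hprod using fun n =>
      exists_zeroFree_orliczMean_le_one hΦ.monotone hp hG h0 (hr.1.trans_lt (hR n).1) (hR n).2
        (hR0 n) hc
    refine orliczMean_le_one_of_eventually_lt hΦ hp (g := fun n => dilate (h n) r)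
      (fun n => continuous_dilate (hcont n) ⟨hr.1, (hR n).1⟩) (fun ζ y hy => ?_) hc0
      fun n => hmean n r ⟨hr.1, (hR n).1⟩
    set z : ℂ := r * ζ with hz
    have hζ : ‖(ζ : ℂ)‖ = 1 := Circle.norm_coe ζ
    have hzr : ‖z‖ = r := by rw [hz, norm_mul, hζ, norm_real, Real.norm_of_nonneg hr.1, mul_one]
    have hzb : z ∈ ball (0 : ℂ) 1 := by rw [mem_ball_zero_iff, hzr]; exact hr.2
    have hGz : G z ≠ 0 := hr0 z (by rw [mem_sphere_zero_iff_norm, hzr])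
    have hBz : blaschkeProduct (zeros G) z ≠ 0 := fun hB => hGz (by rw [hGF z hzb, hB, zero_mul])
    have hlim : Tendsto (fun S : Finset (ZeroIndex G) =>
        (∏ i ∈ S, ‖canonicalFactor 1 (zeros G i) z‖) * ‖G z‖) atTop (𝓝 ‖F z‖) := by
      have h1 := ((tendsto_norm_prod_blaschkeFactor (fun i => zeros_mem_ball i) hs hzb).inv₀
        (norm_ne_zero_iff.2 hBz)).mul_const ‖G z‖
      have h2 : ‖blaschkeProduct (zeros G) z‖⁻¹ * ‖G z‖ = ‖F z‖ := by
        rw [hGF z hzb, norm_mul, inv_mul_cancel_left₀ (norm_ne_zero_iff.2 hBz)]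
      rw [h2] at h1
      simpa only [norm_blaschkeFactor, Finset.prod_inv_distrib, inv_inv] using h1
    -- The finite set `S` is fixed before `n`: its product already exceeds `y` in the limit `R = 1`,
    -- hence also for large `n`.
    obtain ⟨S, hS⟩ := (hlim.eventually (lt_mem_nhds hy)).exists
    filter_upwards [((tendsto_prod_canonicalFactor hR1 hGz S).mul_const _).eventually
      (lt_mem_nhds hS), eventually_zeros_mem_ball hR1 S] with n hn hn'
    exact hn.trans_le (hprod n z (by rw [mem_ball_zero_iff, hzr]; exact (hR n).1) hGz S hn')
  intro r hr
  -- An arbitrary circle is approached from outside by zero-free ones, using continuity of `F` and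
  -- Fatou's lemma once more.
  obtain ⟨R, hR, hR0, hR1⟩ := exists_seq_radius_ne_zero_right hG h0 hr.2
  have hRm : ∀ n, R n ∈ Ico (0 : ℝ) 1 := fun n => ⟨hr.1.trans (hR n).1.le, (hR n).2⟩
  refine orliczMean_le_one_of_eventually_lt hΦ hp (g := fun n => dilate F (R n))
    (fun n => continuous_dilate hF.continuousOn (hRm n)) (fun ζ y hy => ?_) hc0
    fun n => hgood _ (hRm n) (hR0 n)
  have hzb := dilate_mem_ball hr ζ
  have h1 : Tendsto (fun n => ‖F (R n * ζ)‖) atTop (𝓝 ‖F (r * ζ)‖) :=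
    ((hF.continuousOn.continuousAt (isOpen_ball.mem_nhds hzb)).tendsto.comp
      (((continuous_ofReal.tendsto r).comp hR1).mul_const (ζ : ℂ))).norm
  exact h1.eventually (lt_mem_nhds hy)

lemma pos_and_orliczMean_le_one (hΦ : Monotone Φ) (h : hardyNorm Φ G < c) :
    0 < c ∧ ∀ r ∈ Ico (0 : ℝ) 1, orliczMean Φ (dilate G r) c ≤ 1 :=
  ⟨by exact_mod_cast (zero_le).trans_lt h, fun _ hr =>
    orliczMean_le_one hΦ ((luxNorm_le_hardyNorm hr).trans_lt h)⟩

lemma summable_one_sub_norm_zeros_of_hardyNorm_lt_top (hΦ : IsGrowthFunction Φ) (hp : IsPowerConvex Φ)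
    (hG : DifferentiableOn ℂ G (ball 0 1)) (hG' : hardyNorm Φ G < ∞)
    (h0 : ∃ z ∈ ball (0 : ℂ) 1, G z ≠ 0) : Summable fun i => 1 - ‖zeros G i‖ := by
  obtain ⟨c, hc⟩ := ENNReal.lt_iff_exists_nnreal_btwn.1 hG'
  obtain ⟨hc0, hc1⟩ := pos_and_orliczMean_le_one hΦ.monotone hc.1
  exact summable_one_sub_norm_zeros hΦ hp hG h0 hc0 hc1

lemma hardyNorm_quotient_le (hΦ : IsGrowthFunction Φ) (hp : IsPowerConvex Φ)
    (hG : DifferentiableOn ℂ G (ball 0 1)) (h0 : ∃ z ∈ ball (0 : ℂ) 1, G z ≠ 0)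
    {F : ℂ → ℂ} (hF : DifferentiableOn ℂ F (ball 0 1))
    (hGF : ∀ z ∈ ball (0 : ℂ) 1, G z = blaschkeProduct (zeros G) z * F z) :
    hardyNorm Φ F ≤ hardyNorm Φ G := by
  refine le_of_forall_gt_imp_ge_of_dense fun c hc => ?_
  cases c with
  | top => exact le_top
  | coe c =>
    obtain ⟨hc0, hc1⟩ := pos_and_orliczMean_le_one hΦ.monotone hc
    exact iSup₂_le fun r hr => luxNorm_le hc0
      (orliczMean_dilate_quotient_le_one hΦ hp hG h0 hc0 hc1 hF hGF r hr)

end HardyOrlicz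

/-! ### Replacing a growth function of lower type by a power convex one. -/

namespace HardyOrlicz
open Metric Set MeasureTheory Filter Topology

variable {Φ : ℝ≥0 → ℝ≥0} {p : ℝ} {C : ℝ≥0}

/-- A convex function comparable with `u ↦ Φ (u ^ (1 / p))`. -/
def convexification (Φ : ℝ≥0 → ℝ≥0) (p : ℝ) (u : ℝ≥0) : ℝ≥0 :=
  ⨆ v : ℝ≥0, Φ (v ^ (1 / p)) * (u / v - 1)

/-- Truncated subtraction makes the term vanish for `u ≤ v`, and also for `v = 0`. For `u > v`,
lower type with `t = (v / u) ^ (1 / p)` gains a factor `v / u`, which cancels the linear growth `u /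
v`. -/
lemma convexification_term_le (hp : 0 < p)
    (hC : ∀ t s : ℝ≥0, t ≤ 1 → Φ (s * t) ≤ C * t ^ p * Φ s) (u v : ℝ≥0) :
    Φ (v ^ (1 / p)) * (u / v - 1) ≤ C * Φ (u ^ (1 / p)) := by
  rcases eq_or_ne v 0 with rfl | hv
  · simp
  rcases le_total u v with huv | huv
  · have : u / v - 1 = 0 := tsub_eq_zero_of_le (div_le_one_of_le₀ huv (zero_le))
    simp [this]
  have hu : u ≠ 0 := fun h => hv (by simpa [h] using huv)
  have h1 := hC ((v / u) ^ (1 / p)) (u ^ (1 / p))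
    (NNReal.rpow_le_one (div_le_one_of_le₀ huv (zero_le)) (by positivity))
  rw [← NNReal.mul_rpow, mul_div_cancel₀ _ hu, ← NNReal.rpow_mul, one_div_mul_cancel hp.ne',
    NNReal.rpow_one] at h1
  calc Φ (v ^ (1 / p)) * (u / v - 1) ≤ (C * (v / u) * Φ (u ^ (1 / p))) * (u / v) := by
        gcongr; exact tsub_le_self
    _ = C * Φ (u ^ (1 / p)) := by field_simp

lemma bddAbove_convexification (hp : 0 < p)
    (hC : ∀ t s : ℝ≥0, t ≤ 1 → Φ (s * t) ≤ C * t ^ p * Φ s) (u : ℝ≥0) :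
    BddAbove (range fun v : ℝ≥0 => Φ (v ^ (1 / p)) * (u / v - 1)) :=
  ⟨_, forall_mem_range.2 fun v => convexification_term_le hp hC u v⟩

lemma convexification_le (hp : 0 < p)
    (hC : ∀ t s : ℝ≥0, t ≤ 1 → Φ (s * t) ≤ C * t ^ p * Φ s) (u : ℝ≥0) : convexification Φ p u ≤ C * Φ (u ^ (1 / p)) :=
  ciSup_le fun v => convexification_term_le hp hC u v

/-- The term `v = u / 2` of the supremum has second factor `1`. -/
lemma le_convexification (hp : 0 < p)
    (hC : ∀ t s : ℝ≥0, t ≤ 1 → Φ (s * t) ≤ C * t ^ p * Φ s) (h0 : Φ 0 = 0) (u : ℝ≥0) :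
    Φ ((u / 2) ^ (1 / p)) ≤ convexification Φ p u := by
  rcases eq_or_ne u 0 with rfl | hu
  · rw [zero_div, NNReal.zero_rpow (by positivity), h0]; exact zero_le
  refine le_trans (le_of_eq ?_) (le_ciSup (bddAbove_convexification hp hC u) (u / 2))
  have : u / (u / 2) - 1 = 1 := by
    rw [div_div_cancel₀ hu]
    exact tsub_eq_of_eq_add (by norm_num)
  simp only [this, mul_one]

lemma monotone_convexification (hp : 0 < p)
    (hC : ∀ t s : ℝ≥0, t ≤ 1 → Φ (s * t) ≤ C * t ^ p * Φ s) : Monotone (convexification Φ p) := fun u w huw =>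
  ciSup_mono (bddAbove_convexification hp hC w) fun v => by gcongr

/-- Each truncated term is a nonnegative multiple of the positive part of an affine function of `u`,
hence convex, and suprema preserve convexity. -/
lemma convexOn_convexification (hp : 0 < p)
    (hC : ∀ t s : ℝ≥0, t ≤ 1 → Φ (s * t) ≤ C * t ^ p * Φ s) : ConvexOn ℝ≥0 univ (convexification Φ p) := by
  refine ⟨convex_univ, fun x _ y _ a b _ _ hab => ciSup_le fun v => ?_⟩
  have h1 : (a • x + b • y) / v - 1 ≤ a * (x / v - 1) + b * (y / v - 1) := by
    rw [tsub_le_iff_right, ← hab, smul_eq_mul, smul_eq_mul, add_div, mul_div_assoc, mul_div_assoc,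
      add_add_add_comm, ← mul_add_one, ← mul_add_one, hab]
    gcongr <;> exact le_tsub_add
  calc Φ (v ^ (1 / p)) * ((a • x + b • y) / v - 1)
      ≤ Φ (v ^ (1 / p)) * (a * (x / v - 1) + b * (y / v - 1)) := by gcongr
    _ = a * (Φ (v ^ (1 / p)) * (x / v - 1)) + b * (Φ (v ^ (1 / p)) * (y / v - 1)) := by ring
    _ ≤ a • convexification Φ p x + b • convexification Φ p y := by
        rw [smul_eq_mul, smul_eq_mul]
        gcongr
        · exact le_ciSup (bddAbove_convexification hp hC x) v
        · exact le_ciSup (bddAbove_convexification hp hC y) v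

/-- A growth function of lower type is comparable with a power convex growth function. -/
lemma exists_isPowerConvex (hΦ : IsGrowthFunction Φ) (hlow : IsLowerType Φ) :
    ∃ Ψ : ℝ≥0 → ℝ≥0, IsGrowthFunction Ψ ∧ IsPowerConvex Ψ ∧ (∀ t, Ψ t ≤ Φ t) ∧
      ∃ K : ℝ≥0, 0 < K ∧ ∀ t, Φ (t / K) ≤ Ψ t := by
  obtain ⟨p, C, hp, hC1, hC⟩ := hlow
  have hC0 : 0 < C := zero_lt_one.trans hC1
  have hpp : ∀ t : ℝ≥0, (t ^ p) ^ (1 / p) = t := fun t => by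
    rw [← NNReal.rpow_mul, mul_one_div_cancel hp.ne', NNReal.rpow_one]
  have hpp' : ∀ t : ℝ≥0, (t ^ (1 / p)) ^ p = t := fun t => by
    rw [← NNReal.rpow_mul, one_div_mul_cancel hp.ne', NNReal.rpow_one]
  set Ψ : ℝ≥0 → ℝ≥0 := fun t => convexification Φ p (t ^ p) / C with hΨ
  have hle : ∀ t, Ψ t ≤ Φ t := fun t => by
    rw [hΨ]
    refine div_le_of_le_mul₀ (zero_le) (zero_le) ?_
    have := convexification_le hp hC (t ^ p)
    rwa [hpp, mul_comm] at this
  have hge : ∀ t, Φ (t * (1 / 2) ^ (1 / p)) / C ≤ Ψ t := fun t => by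
    have := le_convexification hp hC hΦ.map_zero (t ^ p)
    rw [div_eq_mul_one_div, NNReal.mul_rpow, hpp] at this
    exact div_le_div_of_nonneg_right this (zero_le)
  have hmono : Monotone Ψ := fun s t hst => by
    have := monotone_convexification hp hC (NNReal.rpow_le_rpow hst hp.le)
    exact div_le_div_of_nonneg_right this (zero_le)
  have hhalf : 0 < (1 / 2 : ℝ≥0) ^ (1 / p) := NNReal.rpow_pos (by norm_num)
  refine ⟨Ψ, ⟨hmono, ?_, ?_, ?_, ?_⟩, ⟨p, hp, ?_⟩, hle, ?_⟩
  · exact le_antisymm ((hle 0).trans_eq hΦ.map_zero) (zero_le)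
  · exact tendsto_of_tendsto_of_tendsto_of_le_of_le tendsto_const_nhds hΦ.tendsto_zero
      (fun _ => zero_le) hle
  · exact fun t ht => (div_pos (hΦ.pos _ (mul_pos ht hhalf)) hC0).trans_le (hge t)
  · refine tendsto_atTop_mono hge ?_
    exact (hΦ.tendsto_atTop.comp (tendsto_id.atTop_mul_const hhalf)).atTop_div_const hC0
  · refine ⟨convex_univ, fun x hx y hy a b ha hb hab => ?_⟩
    have := (convexOn_convexification hp hC).2 hx hy ha hb hab
    simp only [hΨ, hpp', smul_eq_mul, ← mul_div_assoc, ← add_div] at this ⊢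
    gcongr
  · have hτ : 0 < ((C ^ 2)⁻¹) ^ (1 / p) := NNReal.rpow_pos (by positivity)
    refine ⟨((1 / 2) ^ (1 / p) * ((C ^ 2)⁻¹) ^ (1 / p))⁻¹, by positivity, fun t => ?_⟩
    rw [div_inv_eq_mul, ← mul_assoc]
    refine (hC _ _ (NNReal.rpow_le_one (inv_le_one_of_one_le₀ (one_le_pow₀ hC1.le))
      (by positivity))).trans (le_trans (le_of_eq ?_) (hge t))
    rw [hpp']
    field_simp

end HardyOrlicz

end
theorem theorem1p1 (Φ : ℝ≥0 → ℝ≥0) (hΦ : HardyOrlicz.IsGrowthFunction Φ)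
    (hlow : HardyOrlicz.IsLowerType Φ) :
    ∃ C : ℝ≥0, 0 < C ∧ ∀ G : ℂ → ℂ, HardyOrlicz.MemHardy Φ G →
      (∃ z ∈ Metric.ball (0 : ℂ) 1, G z ≠ 0) →
      -- the Blaschke product of the zeros of `G` is well defined
      Summable (fun i => 1 - ‖HardyOrlicz.zeros G i‖) ∧
      (∀ z ∈ Metric.ball (0 : ℂ) 1,
        Multipliable fun i => HardyOrlicz.blaschkeFactor (HardyOrlicz.zeros G i) z) ∧
      -- `F` is the holomorphic function `G / B` on the disc
      ∃ F : ℂ → ℂ,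
        (∀ z ∈ Metric.ball (0 : ℂ) 1,
          G z = HardyOrlicz.blaschkeProduct (HardyOrlicz.zeros G) z * F z) ∧
        HardyOrlicz.MemHardy Φ F ∧
        (C : ℝ≥0∞)⁻¹ * HardyOrlicz.hardyNorm Φ F ≤ HardyOrlicz.hardyNorm Φ G ∧
        HardyOrlicz.hardyNorm Φ G ≤ C * HardyOrlicz.hardyNorm Φ F ∧
        -- equality when `t ↦ Φ (t ^ (1 / p))` is convex for some `p`
        ((∃ p : ℝ, 0 < p ∧ ConvexOn ℝ≥0 Set.univ fun t : ℝ≥0 => Φ (t ^ (1 / p))) →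
          HardyOrlicz.hardyNorm Φ F = HardyOrlicz.hardyNorm Φ G) := by
  obtain ⟨Ψ, hΨ, hΨp, hΨΦ, K, hK, hKΨ⟩ := HardyOrlicz.exists_isPowerConvex hΦ hlow
  -- `K` serves the bound for the quotient, `1` the bound from `‖B‖ ≤ 1`.
  refine ⟨max K 1, lt_max_of_lt_left hK, fun G hG h0 => ?_⟩
  have hs := HardyOrlicz.summable_one_sub_norm_zeros_of_hardyNorm_lt_top hΨ hΨp hG.1
    ((HardyOrlicz.hardyNorm_mono_growth hΨΦ G).trans_lt hG.2) h0
  have hz : ∀ i, HardyOrlicz.zeros G i ∈ Metric.ball (0 : ℂ) 1 := HardyOrlicz.zeros_mem_ball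
  obtain ⟨F, hF, hGF⟩ := HardyOrlicz.exists_eq_blaschkeProduct_mul hG.1 h0 hs
  have hFG : HardyOrlicz.hardyNorm Φ F ≤ K * HardyOrlicz.hardyNorm Φ G :=
    (HardyOrlicz.hardyNorm_le_mul hK hKΨ F).trans (mul_le_mul_right
      ((HardyOrlicz.hardyNorm_quotient_le hΨ hΨp hG.1 h0 hF hGF).trans
        (HardyOrlicz.hardyNorm_mono_growth hΨΦ G)) _)
  have hGF' : HardyOrlicz.hardyNorm Φ G ≤ HardyOrlicz.hardyNorm Φ F :=
    HardyOrlicz.hardyNorm_mono_fun hΦ.monotone fun z hzb => by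
      rw [hGF z hzb, norm_mul]
      exact mul_le_of_le_one_left (norm_nonneg _)
        (HardyOrlicz.norm_blaschkeProduct_le_one hz hs hzb)
  have hmax : (1 : ℝ≥0∞) ≤ (max K 1 : ℝ≥0) := by exact_mod_cast le_max_right K 1
  refine ⟨hs, fun z hzb => HardyOrlicz.multipliable_blaschkeFactor hz hs hzb, F, hGF,
    ⟨hF, hFG.trans_lt (ENNReal.mul_lt_top ENNReal.coe_lt_top hG.2)⟩, ?_, ?_, fun hp => ?_⟩
  · rw [ENNReal.inv_mul_le_iff (zero_lt_one.trans_le hmax).ne' ENNReal.coe_ne_top]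
    refine hFG.trans (mul_le_mul_left ?_ _)
    exact_mod_cast le_max_left K 1
  · exact hGF'.trans (le_mul_of_one_le_left (zero_le) hmax)
  -- In the convex case the quotient estimate applies to `Φ` itself, without the loss from `Ψ`.
  · exact le_antisymm (HardyOrlicz.hardyNorm_quotient_le hΦ hp hG.1 h0 hF hGF) hGF'
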